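/- Let $\mathcal L$ denote Lebesgue measure on $\mathbb R^d$, $d\ge 1$, and let $S\subset\mathbb R^d$ be a Borel set with $0<\mathcal L(S)<\infty$. Let $\mathbb M(S)$ be the set of (finite) simple point measures on $S$, i.e. finite sums of unit point masses at distinct points of $S$, with the $\sigma$-algebra generated by the maps $\nu\mapsto\nu(B)$, $B\subset S$ Borel. For $\lambda>\mu>0$, a (deterministic, Poisson) thinning on $S$ from $\lambda$ to $\mu$ is a measurable function $f:\mathbb M(S)\to\mathbb M(S)$ such that, if $\Pi$ is a homogeneous Poisson process of intensity $\lambda$ on $S$, then $f(\Pi)$ is a homogeneous Poisson process of intensity $\mu$ on $S$, and almost surely every point of $f(\Pi)$ is a point of $\Pi$. Corollary (Non-monotonicity in $\mu$). (a) For every $d\ge1$ and every such $S$ there exist real numbers $\lambda>\mu>\mu'>0$ such that there is a thinning on $S$ from $\lambda$ to $\mu$, but there is no thinning on $S$ from $\lambda$ to $\mu'$. (b) If $\mathcal L(S)=1$, in particular if $S=[0,1]\subset\mathbb R$, then $(\lambda,\mu,\mu')=(1.45,\,0.7,\,0.6)$ is such an example. -/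

import Mathlib

open MeasureTheory ProbabilityTheory
open scoped NNReal ENNReal

/-- A (finite) simple point measure on `α`: a finite sum of unit point masses at distinct points.
It carries the σ-algebra generated by the counting maps `ν ↦ ν B`, `B` measurable (inherited from
the σ-algebra of `Measure α`). -/
abbrev SimplePointMeasure (α : Type*) [MeasurableSpace α] : Type _ :=
  {ν : Measure α // ∃ s : Finset α, ν = ∑ x ∈ s, Measure.dirac x}

/-- The set of points (atoms) of a simple point measure. -/
def SimplePointMeasure.points {α : Type*} [MeasurableSpace α] (ν : SimplePointMeasure α) : Set α :=
  {x | ν.1 {x} = 1}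

/-- The random simple point measure `N`, defined on the probability space `(Ω, P)`, is a Poisson
point process on `α` with (finite) mean measure `m`: the number of points in a measurable set `B`
is Poisson with mean `m B`, and the numbers of points in disjoint sets are independent. -/
structure IsPoissonProcess {Ω α : Type*} [MeasurableSpace Ω] [MeasurableSpace α]
    (m : Measure α) (N : Ω → SimplePointMeasure α) (P : Measure Ω) : Prop where
  measurable : Measurable N
  count_law : ∀ B : Set α, MeasurableSet B →
    HasLaw (fun ω => (N ω).1 B)
      ((poissonMeasure (m B).toNNReal).map (fun n : ℕ => (n : ℝ≥0∞))) P
  count_indep : ∀ (n : ℕ) (B : Fin n → Set α), (∀ i, MeasurableSet (B i)) →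
    Pairwise (fun i j => Disjoint (B i) (B j)) →
    iIndepFun (fun i ω => (N ω).1 (B i)) P

/-- `f` is a (deterministic, Poisson) thinning on `S` from `r` to `s`: a measurable map such that,
for a homogeneous Poisson process of intensity `r` on `S`, the image process is homogeneous
Poisson of intensity `s` on `S`, and almost surely every point of the image is a point of the
original process. The process is taken on its canonical space (`P` is its law, `id` the process);
the law is determined by `S` and `r`, so the choice of `P` is immaterial. -/
def IsThinning {E : Type*} [MeasureSpace E] (S : Set E) (r s : ℝ≥0)
    (f : SimplePointMeasure S → SimplePointMeasure S) : Prop :=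
  Measurable f ∧
    ∃ P : Measure (SimplePointMeasure S), IsProbabilityMeasure P ∧
      IsPoissonProcess (r • volume.comap (Subtype.val : S → E)) id P ∧
      IsPoissonProcess (s • volume.comap (Subtype.val : S → E)) f P ∧
      ∀ᵐ ν ∂P, (f ν).points ⊆ ν.points

/-- There is a thinning on `S` from `r` to `s`. -/
def ThinningExists {E : Type*} [MeasureSpace E] (S : Set E) (r s : ℝ≥0) : Prop :=
  ∃ f : SimplePointMeasure S → SimplePointMeasure S, IsThinning S r s f

/-!
Normalize Lebesgue measure on `S` to a probability measure `ρ` without atoms, so that `r` and `s`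
become the mean numbers of points.

*Non-existence.* Suppose a thinning from `r` to `s` exists, and let `A` be the set of points that
it retains when they are alone. A configuration consisting of one point of `A` is left unchanged,
so `exp (-r) * r * ρ A ≤ exp (-s) * s * ρ A`. If `s * exp (-s) < r * exp (-r)`, then `A` is null
and almost every configuration with at most one point becomes empty, whence
`(1 + r) * exp (-r) ≤ exp (-s)`. For `r = 1.45` and `s = 0.6` this is false.

*Existence.* The only randomness available is that of the points themselves, and one of them is
sacrificed for it. Encode each point as a pair of independent uniform variables, a label and a
height. The sum modulo `1` of all the labels is independent of all the heights and of the labels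
of all points but one. Let this sum select a number `k` and then a uniform `k`-element subset of
the ranks of the heights. Whenever some point is lost, the retained ones are, given their number,
again independent with law `ρ`. Hence a coupling `(n, k)` of the two Poisson counts is realized by
a thinning as soon as each value of `n` has either `k = n` almost surely or `k < n` almost surely.
For `r = 1.45` and `s = 0.7`, keep all points when `n ≤ 1`; what remains of the two Poisson laws
admits a coupling with `k < n`.
-/

namespace SimplePointMeasure

variable {α : Type*} [MeasurableSpace α]

instance instIsFiniteMeasure (ν : SimplePointMeasure α) : IsFiniteMeasure ν.1 := by
  obtain ⟨s, hs⟩ := ν.2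
  rw [hs]
  infer_instance

lemma measurable_apply {B : Set α} (hB : MeasurableSet B) :
    Measurable fun ν : SimplePointMeasure α => ν.1 B :=
  (Measure.measurable_coe hB).comp measurable_subtype_coe

/-- The simple point measure whose points are the elements of the finite set `s`. -/
noncomputable def ofFinset (s : Finset α) : SimplePointMeasure α :=
  ⟨∑ x ∈ s, Measure.dirac x, s, rfl⟩

lemma exists_eq_ofFinset (ν : SimplePointMeasure α) : ∃ s, ν = ofFinset s :=
  let ⟨s, hs⟩ := ν.2
  ⟨s, Subtype.ext hs⟩

lemma ofFinset_apply (s : Finset α) {B : Set α} [DecidablePred (· ∈ B)] (hB : MeasurableSet B) :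
    (ofFinset s).1 B = (s.filter (· ∈ B)).card := by
  simp [ofFinset, Measure.finsetSum_apply, Measure.dirac_apply' _ hB, Set.indicator_apply]

lemma ofFinset_apply_univ (s : Finset α) : (ofFinset s).1 Set.univ = s.card := by
  classical
  simp [ofFinset_apply s MeasurableSet.univ]

lemma ofFinset_singleton_apply (x : α) {B : Set α} (hB : MeasurableSet B) :
    (ofFinset {x}).1 B = B.indicator 1 x := by
  simp [ofFinset, Measure.dirac_apply' x hB]

lemma measurable_ofFinset_singleton : Measurable fun x : α => ofFinset {x} := by
  refine Measurable.subtype_mk ?_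
  simpa using Measure.measurable_dirac

lemma exists_eq_ofFinset_singleton (ν : SimplePointMeasure α) {B : Set α}
    (hB : MeasurableSet B) (h₁ : ν.1 B = 1) (h₀ : ν.1 Bᶜ = 0) : ∃ x ∈ B, ν = ofFinset {x} := by
  classical
  obtain ⟨s, rfl⟩ := ν.exists_eq_ofFinset
  have hcard : s.card = 1 := by
    have := measure_add_measure_compl (μ := (ofFinset s).1) hB
    rw [h₁, h₀, add_zero, ofFinset_apply_univ] at this
    exact_mod_cast this.symm
  obtain ⟨x, rfl⟩ := Finset.card_eq_one.1 hcard
  refine ⟨x, ?_, rfl⟩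
  by_contra hx
  simp [ofFinset_singleton_apply x hB, hx] at h₁

section Points

variable [MeasurableSingletonClass α]

@[simp]
lemma points_ofFinset (s : Finset α) : (ofFinset s).points = s := by
  classical
  ext x
  rw [points, Set.mem_ofPred_eq, ofFinset_apply s (measurableSet_singleton x), Nat.cast_eq_one,
    Finset.card_eq_one, SetLike.mem_coe]
  refine ⟨fun ⟨y, hy⟩ => ?_, fun hx => ⟨x, by grind⟩⟩
  have : y ∈ s.filter (· ∈ ({x} : Set α)) := hy ▸ Finset.mem_singleton_self y
  grind

lemma eq_zero_or_eq_of_points_subset_singleton {ν : SimplePointMeasure α} {x : α}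
    (h : ν.points ⊆ (ofFinset {x}).points) : ν = ofFinset ∅ ∨ ν = ofFinset {x} := by
  obtain ⟨s, rfl⟩ := ν.exists_eq_ofFinset
  rw [points_ofFinset, points_ofFinset, Finset.coe_subset, Finset.subset_singleton_iff] at h
  exact h.imp (congrArg _) (congrArg _)

lemma univ_le_univ_of_points_subset {ν ν' : SimplePointMeasure α} (h : ν.points ⊆ ν'.points) :
    ν.1 Set.univ ≤ ν'.1 Set.univ := by
  obtain ⟨s, rfl⟩ := ν.exists_eq_ofFinset
  obtain ⟨s', rfl⟩ := ν'.exists_eq_ofFinset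
  rw [points_ofFinset, points_ofFinset, Finset.coe_subset] at h
  rw [ofFinset_apply_univ, ofFinset_apply_univ]
  exact_mod_cast Finset.card_le_card h

end Points

end SimplePointMeasure

namespace IsPoissonProcess

variable {Ω α : Type*} [MeasurableSpace Ω] [MeasurableSpace α] {m : Measure α}
  {N : Ω → SimplePointMeasure α} {P : Measure Ω}

lemma measure_apply_mem (h : IsPoissonProcess m N P) {B : Set α} (hB : MeasurableSet B)
    {T : Set ℝ≥0∞} (hT : MeasurableSet T) :
    P {ω | (N ω).1 B ∈ T} = poissonMeasure (m B).toNNReal ((↑) ⁻¹' T) := by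
  rw [← Measure.map_apply .of_discrete hT, ← (h.count_law B hB).map_eq,
    Measure.map_apply_of_aemeasurable (h.count_law B hB).aemeasurable hT]
  rfl

lemma measure_apply_eq (h : IsPoissonProcess m N P) {B : Set α} (hB : MeasurableSet B) (k : ℕ) :
    P {ω | (N ω).1 B = k} =
      ENNReal.ofReal (Real.exp (-m.real B) * m.real B ^ k / k.factorial) := by
  have hpre : ((↑) : ℕ → ℝ≥0∞) ⁻¹' {(k : ℝ≥0∞)} = {k} := by
    ext
    simp
  have := h.measure_apply_mem hB (measurableSet_singleton (k : ℝ≥0∞))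
  rwa [hpre, poissonMeasure_singleton] at this

lemma measure_unique_point_mem [IsFiniteMeasure m] (h : IsPoissonProcess m N P) {B : Set α}
    (hB : MeasurableSet B) :
    P {ω | (N ω).1 B = 1 ∧ (N ω).1 Bᶜ = 0} =
      ENNReal.ofReal (Real.exp (-m.real Set.univ) * m.real B) := by
  have hindep := h.count_indep 2 ![B, Bᶜ] (by simp [Fin.forall_fin_two, hB]) (by
    simp [Pairwise, Fin.forall_fin_two, disjoint_compl_right, disjoint_compl_left])
  have hmul : P {ω | (N ω).1 B = 1 ∧ (N ω).1 Bᶜ = 0} =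
      P {ω | (N ω).1 B = (1 : ℕ)} * P {ω | (N ω).1 Bᶜ = (0 : ℕ)} := by
    rw [Nat.cast_one, Nat.cast_zero]
    exact (hindep.indepFun (i := 0) (j := 1) (by decide)).measure_inter_preimage_eq_mul
      {1} {0} (measurableSet_singleton _) (measurableSet_singleton _)
  rw [hmul, h.measure_apply_eq hB, h.measure_apply_eq hB.compl,
    ← ENNReal.ofReal_mul (by positivity), ← measureReal_add_measureReal_compl hB, neg_add,
    Real.exp_add]
  congr 1
  simp only [pow_one, Nat.factorial_one, Nat.cast_one, div_one, pow_zero, mul_one,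
    Nat.factorial_zero]
  ring

lemma measure_univ_le_one (h : IsPoissonProcess m N P) :
    P {ω | (N ω).1 Set.univ ≤ 1} =
      ENNReal.ofReal (Real.exp (-m.real Set.univ) * (1 + m.real Set.univ)) := by
  have hpre : ((↑) : ℕ → ℝ≥0∞) ⁻¹' Set.Iic 1 = {0} ∪ {1} := by
    ext k
    simpa [or_comm] using Nat.le_one_iff_eq_zero_or_eq_one (n := k)
  have := h.measure_apply_mem MeasurableSet.univ (T := Set.Iic 1) measurableSet_Iic
  rw [hpre, measure_union (by simp) (by simp), poissonMeasure_singleton, poissonMeasure_singleton,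
    ← ENNReal.ofReal_add (by positivity) (by positivity)] at this
  simp only [pow_zero, pow_one, Nat.factorial_zero, Nat.factorial_one, Nat.cast_one,
    div_one] at this
  rwa [← mul_add] at this

end IsPoissonProcess

/-- Thinning between Poisson processes with arbitrary mean measures `m` and `m'`; `ThinningExists`
is the case of two multiples of Lebesgue measure on a set. -/
def PoissonThinningExists {α : Type*} [MeasurableSpace α] (m m' : Measure α) : Prop :=
  ∃ f : SimplePointMeasure α → SimplePointMeasure α, Measurable f ∧
    ∃ P : Measure (SimplePointMeasure α), IsProbabilityMeasure P ∧
      IsPoissonProcess m id P ∧ IsPoissonProcess m' f P ∧ ∀ᵐ ν ∂P, (f ν).points ⊆ ν.points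

section Nonexistence

open SimplePointMeasure

variable {α : Type*} [MeasurableSpace α]
  {f : SimplePointMeasure α → SimplePointMeasure α} {P : Measure (SimplePointMeasure α)}

/-- The points that `f` retains when they are the only point of the configuration. -/
def retainedSingletons (f : SimplePointMeasure α → SimplePointMeasure α) : Set α :=
  {x | (f (ofFinset {x})).1 Set.univ = 1}

lemma measurableSet_retainedSingletons (hf : Measurable f) :
    MeasurableSet (retainedSingletons f) :=
  ((measurable_apply MeasurableSet.univ).comp (hf.comp measurable_ofFinset_singleton))
    (measurableSet_singleton 1)

variable [MeasurableSingletonClass α]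

lemma map_ofFinset_singleton_of_mem_retainedSingletons {x : α} (hx : x ∈ retainedSingletons f)
    (hsub : (f (ofFinset {x})).points ⊆ (ofFinset {x}).points) :
    f (ofFinset {x}) = ofFinset {x} :=
  (eq_zero_or_eq_of_points_subset_singleton hsub).resolve_left fun h0 => by
    simp [retainedSingletons, h0, ofFinset_apply_univ] at hx

lemma map_ofFinset_singleton_of_notMem_retainedSingletons {x : α}
    (hx : x ∉ retainedSingletons f)
    (hsub : (f (ofFinset {x})).points ⊆ (ofFinset {x}).points) :
    f (ofFinset {x}) = ofFinset ∅ :=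
  (eq_zero_or_eq_of_points_subset_singleton hsub).resolve_right fun h1 =>
    hx (by simp [retainedSingletons, h1, ofFinset_apply_univ])

lemma measure_retainedSingletons_le {m m' : Measure α} [IsFiniteMeasure m] [IsFiniteMeasure m']
    (hm : IsPoissonProcess m id P) (hm' : IsPoissonProcess m' f P)
    (hsub : ∀ᵐ ν ∂P, (f ν).points ⊆ ν.points) :
    Real.exp (-m.real Set.univ) * m.real (retainedSingletons f) ≤
      Real.exp (-m'.real Set.univ) * m'.real (retainedSingletons f) := by
  have hA := measurableSet_retainedSingletons hm'.measurable
  rw [← ENNReal.ofReal_le_ofReal_iff (by positivity), ← hm.measure_unique_point_mem hA,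
    ← hm'.measure_unique_point_mem hA]
  refine measure_mono_ae ?_
  filter_upwards [hsub] with ν hν ⟨h₁, h₀⟩
  obtain ⟨x, hx, rfl⟩ := ν.exists_eq_ofFinset_singleton hA h₁ h₀
  change (f (ofFinset {x})).1 _ = 1 ∧ (f (ofFinset {x})).1 _ = 0
  rw [map_ofFinset_singleton_of_mem_retainedSingletons hx hν]
  exact ⟨h₁, h₀⟩

lemma exp_mul_one_add_le_of_measure_retainedSingletons {m m' : Measure α} [IsFiniteMeasure m]
    (hm : IsPoissonProcess m id P) (hm' : IsPoissonProcess m' f P)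
    (hsub : ∀ᵐ ν ∂P, (f ν).points ⊆ ν.points) (hzero : m.real (retainedSingletons f) = 0) :
    Real.exp (-m.real Set.univ) * (1 + m.real Set.univ) ≤ Real.exp (-m'.real Set.univ) := by
  have hA := measurableSet_retainedSingletons hm'.measurable
  have hempty : ∀ᵐ ν ∂P, ¬ (ν.1 (retainedSingletons f) = 1 ∧ ν.1 (retainedSingletons f)ᶜ = 0) :=
    ae_iff.2 (by simpa [hzero] using hm.measure_unique_point_mem hA)
  have hnone := hm'.measure_apply_eq MeasurableSet.univ 0
  simp only [Nat.cast_zero, pow_zero, mul_one, Nat.factorial_zero, Nat.cast_one, div_one] at hnone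
  rw [← ENNReal.ofReal_le_ofReal_iff (by positivity), ← hm.measure_univ_le_one, ← hnone]
  refine measure_mono_ae ?_
  filter_upwards [hsub, hempty] with ν hν hνA hcard
  change (f ν).1 Set.univ = 0
  obtain ⟨s, rfl⟩ := ν.exists_eq_ofFinset
  have hs : s.card ≤ 1 := by exact_mod_cast (ofFinset_apply_univ s).symm.trans_le hcard
  rcases Nat.le_one_iff_eq_zero_or_eq_one.1 hs with h | h
  · obtain rfl := Finset.card_eq_zero.1 h
    exact le_antisymm ((univ_le_univ_of_points_subset hν).trans (by simp [ofFinset_apply_univ]))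
      zero_le
  · obtain ⟨x, rfl⟩ := Finset.card_eq_one.1 h
    have hx : x ∉ retainedSingletons f := fun hx =>
      hνA (by simp [ofFinset_singleton_apply x, hA, hA.compl, hx])
    simp [map_ofFinset_singleton_of_notMem_retainedSingletons hx hν, ofFinset_apply_univ]

theorem not_poissonThinningExists_smul {ρ : Measure α} [IsProbabilityMeasure ρ] {r s : ℝ≥0}
    (hone : s * Real.exp (-s) < r * Real.exp (-r))
    (hnone : Real.exp (-s) < (1 + r) * Real.exp (-r)) :
    ¬ PoissonThinningExists (r • ρ) (s • ρ) := by
  rintro ⟨f, -, P, -, hr, hs, hsub⟩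
  have hmass (c : ℝ≥0) : (c • ρ).real Set.univ = c := by simp
  have hkeep := measure_retainedSingletons_le hr hs hsub
  simp only [hmass, measureReal_nnreal_smul_apply] at hkeep
  have hzero : ρ.real (retainedSingletons f) = 0 := by
    have := measureReal_nonneg (μ := ρ) (s := retainedSingletons f)
    nlinarith
  have hle := exp_mul_one_add_le_of_measure_retainedSingletons hr hs hsub (by simp [hzero])
  simp only [hmass] at hle
  linarith

end Nonexistence

section IID

variable {ι κ β : Type*} [Fintype ι] [Fintype κ] [MeasurableSpace β]

lemma measurePreserving_comp_of_injective (ρ : Measure β) [IsProbabilityMeasure ρ] {e : κ → ι}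
    (he : Function.Injective e) :
    MeasurePreserving (fun x : ι → β => x ∘ e) (Measure.pi fun _ => ρ) (Measure.pi fun _ => ρ) := by
  refine ⟨by fun_prop, ?_⟩
  have hindep := (iIndepFun_pi (μ := fun _ : ι => ρ) (X := fun _ => id)
    fun _ => aemeasurable_id).precomp he
  refine (hindep.map_fun_eq_pi_map fun k => (measurable_pi_apply (e k)).aemeasurable).trans ?_
  congr 1
  exact funext fun k => (measurePreserving_eval (fun _ => ρ) (e k)).map_eq

lemma ae_injective_pi [MeasurableEq β] (ρ : Measure β) [IsProbabilityMeasure ρ]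
    [NullSingletonClass ρ] : ∀ᵐ x ∂Measure.pi fun _ : ι => ρ, Function.Injective x := by
  have hdiag : ∀ᵐ p ∂ρ.prod ρ, p.1 ≠ p.2 := by
    refine (Measure.ae_prod_iff_ae_ae (p := fun p : β × β => p.1 ≠ p.2)
      measurableSet_diagonal.compl).2 ?_
    filter_upwards with y
    filter_upwards [compl_mem_ae_iff.2 (measure_singleton y)] with z hz using Ne.symm hz
  have hne (i j : ι) (hij : i ≠ j) : ∀ᵐ x ∂Measure.pi fun _ : ι => ρ, x i ≠ x j := by
    have he : Function.Injective ![i, j] := by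
      simpa [Function.Injective, Fin.forall_fin_two, eq_comm] using hij
    exact ((measurePreserving_finTwoArrow ρ).comp
      (measurePreserving_comp_of_injective ρ he)).quasiMeasurePreserving.ae hdiag
  have hne' : ∀ᵐ x ∂Measure.pi fun _ : ι => ρ, ∀ i j, i ≠ j → x i ≠ x j := by
    simpa only [ae_all_iff] using hne
  filter_upwards [hne'] with x hx i j hij
  exact not_imp_not.1 (hx i j) hij

end IID

namespace SimplePointMeasure

variable {α : Type*} [MeasurableSpace α]

lemma integrable [MeasurableSingletonClass α] (ν : SimplePointMeasure α) (g : α → ℝ) :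
    Integrable g ν.1 := by
  obtain ⟨s, rfl⟩ := ν.exists_eq_ofFinset
  exact integrable_finsetSum_measure.2 fun x _ => integrable_dirac (by simp)

lemma integral_ofFinset [MeasurableSingletonClass α] (s : Finset α) (g : α → ℝ) :
    ∫ x, g x ∂(ofFinset s).1 = ∑ x ∈ s, g x := by
  rw [ofFinset, integral_finsetSum_measure fun x _ => integrable_dirac (by simp)]
  simp

lemma measurable_integral [MeasurableSingletonClass α] {g : α → ℝ} (hg : Measurable g) :
    Measurable fun ν : SimplePointMeasure α => ∫ x, g x ∂ν.1 := by
  have hlint {h : α → ℝ≥0∞} (hh : Measurable h) :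
      Measurable fun ν : SimplePointMeasure α => ∫⁻ x, h x ∂ν.1 :=
    (Measure.measurable_lintegral hh).comp measurable_subtype_coe
  simp only [integral_eq_lintegral_pos_part_sub_lintegral_neg_part (integrable _ g)]
  exact (hlint hg.ennreal_ofReal).ennreal_toReal.sub (hlint hg.neg.ennreal_ofReal).ennreal_toReal

lemma integral_sum_indicator (ν : SimplePointMeasure α) {n : ℕ} {B : Fin n → Set α}
    (hB : ∀ j, MeasurableSet (B j)) (t : Fin n → ℝ) :
    ∫ x, ∑ j, (B j).indicator (fun _ => t j) x ∂ν.1 = ∑ j, (ν.1 (B j)).toReal * t j := by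
  rw [integral_finsetSum _ fun j _ => (integrable_const _).indicator (hB j)]
  simp [integral_indicator_const, hB, measureReal_def]

end SimplePointMeasure

section CharacteristicFunctional

open Complex

variable {Ω α : Type*} [MeasurableSpace Ω] [MeasurableSpace α] {m : Measure α} [IsFiniteMeasure m]
  {P : Measure Ω} {N : Ω → SimplePointMeasure α}

lemma integral_cexp_sum_indicator_sub_one {n : ℕ} {B : Fin n → Set α}
    (hB : ∀ j, MeasurableSet (B j)) (hdisj : Pairwise (Function.onFun Disjoint B))
    (t : Fin n → ℝ) :
    ∫ x, (cexp ((∑ j, (B j).indicator (fun _ => t j) x : ℝ) * I) - 1) ∂m =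
      ∑ j, (m (B j)).toReal * (cexp (t j * I) - 1) := by
  have hpoint (x : α) : cexp ((∑ j, (B j).indicator (fun _ => t j) x : ℝ) * I) - 1 =
      ∑ j, (B j).indicator (fun _ => cexp (t j * I) - 1) x := by
    by_cases hx : ∃ k, x ∈ B k
    · obtain ⟨k, hk⟩ := hx
      have hout (j : Fin n) (hj : j ≠ k) : x ∉ B j :=
        fun hxj => Set.disjoint_left.1 (hdisj hj) hxj hk
      rw [Fintype.sum_eq_single k fun j hj => Set.indicator_of_notMem (hout j hj) _,
        Fintype.sum_eq_single k fun j hj => Set.indicator_of_notMem (hout j hj) _,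
        Set.indicator_of_mem hk, Set.indicator_of_mem hk]
    · push Not at hx
      simp [hx]
  simp only [hpoint]
  rw [integral_finsetSum _ fun j _ => (integrable_const _).indicator (hB j)]
  simp [integral_indicator_const, hB, measureReal_def]

lemma integral_cexp_sum_apply_of_charFunctional
    (h : ∀ g : α → ℝ, Measurable g →
      ∫ ω, cexp ((∫ x, g x ∂(N ω).1 : ℝ) * I) ∂P = cexp (∫ x, (cexp (g x * I) - 1) ∂m))
    {n : ℕ} {B : Fin n → Set α} (hB : ∀ j, MeasurableSet (B j))
    (hdisj : Pairwise (Function.onFun Disjoint B)) (t : Fin n → ℝ) :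
    ∫ ω, cexp ((∑ j, ((N ω).1 (B j)).toReal * t j : ℝ) * I) ∂P =
      ∏ j, cexp ((m (B j)).toReal * (cexp (t j * I) - 1)) := by
  have := h (fun x => ∑ j, (B j).indicator (fun _ => t j) x)
    (Finset.measurable_fun_sum _ fun j _ => measurable_const.indicator (hB j))
  rw [integral_cexp_sum_indicator_sub_one hB hdisj, exp_sum] at this
  simpa only [SimplePointMeasure.integral_sum_indicator _ hB] using this

lemma charFun_map_toReal_apply_of_charFunctional (hN : Measurable N)
    (h : ∀ g : α → ℝ, Measurable g →
      ∫ ω, cexp ((∫ x, g x ∂(N ω).1 : ℝ) * I) ∂P = cexp (∫ x, (cexp (g x * I) - 1) ∂m))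
    {B : Set α} (hB : MeasurableSet B) (t : ℝ) :
    charFun (P.map fun ω => ((N ω).1 B).toReal) t =
      cexp ((m B).toReal * (cexp (t * I) - 1)) := by
  have hmeas : Measurable fun ω => ((N ω).1 B).toReal :=
    ((SimplePointMeasure.measurable_apply hB).comp hN).ennreal_toReal
  have := integral_cexp_sum_apply_of_charFunctional h (n := 1) (fun _ => hB)
    (fun i j hij => absurd (Subsingleton.elim i j) hij) fun _ => t
  rw [charFun_apply, integral_map hmeas.aemeasurable (by fun_prop)]
  simpa [mul_comm t] using this

theorem IsPoissonProcess.of_charFunctional [IsProbabilityMeasure P] (hN : Measurable N)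
    (h : ∀ g : α → ℝ, Measurable g →
      ∫ ω, cexp ((∫ x, g x ∂(N ω).1 : ℝ) * I) ∂P = cexp (∫ x, (cexp (g x * I) - 1) ∂m)) :
    IsPoissonProcess m N P := by
  have hmeas {B : Set α} (hB : MeasurableSet B) : Measurable fun ω => (N ω).1 B :=
    (SimplePointMeasure.measurable_apply hB).comp hN
  have hofReal (B : Set α) :
      (fun ω => (N ω).1 B) = ENNReal.ofReal ∘ fun ω => ((N ω).1 B).toReal := by
    ext
    simp
  refine ⟨hN, fun B hB => ⟨(hmeas hB).aemeasurable, ?_⟩, fun n B hB hdisj => ?_⟩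
  · have := Measure.isProbabilityMeasure_map (μ := P) (hmeas hB).ennreal_toReal.aemeasurable
    have hreal : P.map (fun ω => ((N ω).1 B).toReal) =
        (poissonMeasure (m B).toNNReal).map (Nat.cast : ℕ → ℝ) := by
      refine Measure.ext_of_charFun (funext fun t => ?_)
      rw [charFun_map_toReal_apply_of_charFunctional hN h hB, charFun_map_cast_poissonMeasure]
      rfl
    rw [hofReal B, ← Measure.map_map ENNReal.measurable_ofReal (hmeas hB).ennreal_toReal, hreal,
      Measure.map_map ENNReal.measurable_ofReal .of_discrete]
    congr 1
    ext
    simp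
  · suffices hreal : iIndepFun (fun i ω => ((N ω).1 (B i)).toReal) P by
      convert hreal.comp (fun _ => ENNReal.ofReal) fun _ => ENNReal.measurable_ofReal with i
      exact congrFun (hofReal (B i)) _
    rw [iIndepFun_iff_charFun_pi fun i => (hmeas (hB i)).ennreal_toReal.aemeasurable]
    intro t
    have hvec : Measurable fun ω => WithLp.toLp 2 fun i => ((N ω).1 (B i)).toReal :=
      (WithLp.measurable_toLp 2 _).comp
        (measurable_pi_lambda _ fun i => (hmeas (hB i)).ennreal_toReal)
    rw [charFun_apply, integral_map hvec.aemeasurable (by fun_prop), Finset.prod_congr rfl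
      fun i _ => charFun_map_toReal_apply_of_charFunctional hN h (hB i) (t i),
      ← integral_cexp_sum_apply_of_charFunctional h hB hdisj fun i => t i]
    simp [PiLp.inner_apply, mul_comm]

end CharacteristicFunctional

namespace SimplePointMeasure

variable {α ι : Type*} [MeasurableSpace α]

lemma measurableSet_injective [Countable ι] [MeasurableEq α] :
    MeasurableSet {x : ι → α | Function.Injective x} := by
  have hset : {x : ι → α | Function.Injective x} = ⋂ i, ⋂ j, {x | x i = x j → i = j} := by
    ext
    simp [Function.Injective]
  rw [hset]
  refine .iInter fun i => .iInter fun j => ?_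
  by_cases hij : i = j
  · simp [hij]
  · simp only [hij, imp_false]
    exact (measurableSet_eq_fun (measurable_pi_apply i) (measurable_pi_apply j)).compl

variable [Fintype ι]

open Classical in
/-- The simple point measure whose points are the entries of the tuple `x`. When the entries are
not distinct, which has probability zero for independent atomless entries, it is the zero
measure. -/
noncomputable def ofTuple (x : ι → α) : SimplePointMeasure α :=
  if hx : Function.Injective x then ofFinset (Finset.univ.map ⟨x, hx⟩) else ofFinset ∅

lemma ofTuple_eq_ofFinset {x : ι → α} (hx : Function.Injective x) :
    ofTuple x = ofFinset (Finset.univ.map ⟨x, hx⟩) :=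
  dif_pos hx

lemma integral_ofTuple [MeasurableSingletonClass α] {x : ι → α} (hx : Function.Injective x)
    (g : α → ℝ) : ∫ y, g y ∂(ofTuple x).1 = ∑ i, g (x i) := by
  simp [ofTuple_eq_ofFinset hx, integral_ofFinset]

lemma measurable_ofTuple [MeasurableEq α] :
    Measurable (ofTuple : (ι → α) → SimplePointMeasure α) := by
  classical
  have hsum : Measurable fun x : ι → α => ∑ i, Measure.dirac (x i) :=
    Measure.measurable_of_measurable_coe _ fun B hB => by
      simp only [Measure.finsetSum_apply]
      exact Finset.measurable_fun_sum _ fun i _ => (Measure.measurable_coe hB).comp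
        (Measure.measurable_dirac.comp (measurable_pi_apply i))
  have hcoe : (fun x : ι → α => (ofTuple x).1) =
      fun x => if Function.Injective x then ∑ i, Measure.dirac (x i) else 0 := by
    ext1 x
    by_cases hx : Function.Injective x <;> simp [ofTuple, ofFinset, hx]
  have hmeas : Measurable fun x : ι → α => (ofTuple x).1 :=
    hcoe ▸ Measurable.ite measurableSet_injective hsum measurable_const
  exact hmeas.subtype_mk

lemma measurable_cexp_integral [MeasurableSingletonClass α] {g : α → ℝ} (hg : Measurable g) :
    Measurable fun ν : SimplePointMeasure α => Complex.exp ((∫ x, g x ∂ν.1 : ℝ) * Complex.I) := by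
  have := measurable_integral hg
  fun_prop

end SimplePointMeasure

section PoissonLaw

open SimplePointMeasure

variable {α : Type*} [MeasurableSpace α]

/-- The binomial point process: `iidLaw ρ n` is the law of the point measure of `n` independent
points with common law `ρ`. -/
noncomputable def iidLaw (ρ : Measure α) : Kernel ℕ (SimplePointMeasure α) where
  toFun n := (Measure.pi fun _ : Fin n => ρ).map ofTuple
  measurable' := .of_discrete

lemma iidLaw_apply (ρ : Measure α) (n : ℕ) :
    iidLaw ρ n = (Measure.pi fun _ : Fin n => ρ).map ofTuple := rfl

/-- The law of the point measure of `n` independent points with common law `ρ`, where `n` is a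
Poisson variable of mean `r`; it is the law of the Poisson process with mean measure `r • ρ`. -/
noncomputable def poissonLaw (ρ : Measure α) (r : ℝ≥0) : Measure (SimplePointMeasure α) :=
  iidLaw ρ ∘ₘ poissonMeasure r

variable [MeasurableEq α] {ρ : Measure α} [IsProbabilityMeasure ρ]

instance instIsMarkovKernelIidLaw : IsMarkovKernel (iidLaw ρ) :=
  ⟨fun _ => Measure.isProbabilityMeasure_map measurable_ofTuple.aemeasurable⟩

instance instIsProbabilityMeasurePoissonLaw (r : ℝ≥0) : IsProbabilityMeasure (poissonLaw ρ r) := by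
  rw [poissonLaw]
  infer_instance

open Complex

lemma integral_pow_poissonMeasure (r : ℝ≥0) (z : ℂ) :
    ∫ n, z ^ n ∂poissonMeasure r = cexp (r * (z - 1)) := by
  have hterm (n : ℕ) : (Real.exp (-r) * (r : ℝ) ^ n / n.factorial) • z ^ n =
      cexp (-r) * ((r * z) ^ n / n.factorial) := by
    rw [real_smul]
    push_cast
    ring
  simp only [integral_poissonMeasure, hterm]
  rw [tsum_mul_left, (NormedSpace.expSeries_div_hasSum_exp (r * z : ℂ)).tsum_eq, ← exp_eq_exp_ℂ,
    ← exp_add]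
  ring_nf

variable [NullSingletonClass ρ]

lemma integral_cexp_integral_iidLaw (n : ℕ) {g : α → ℝ} (hg : Measurable g) :
    ∫ ν, cexp ((∫ x, g x ∂ν.1 : ℝ) * I) ∂iidLaw ρ n = (∫ x, cexp (g x * I) ∂ρ) ^ n := by
  rw [iidLaw_apply, integral_map measurable_ofTuple.aemeasurable
    (measurable_cexp_integral hg).aestronglyMeasurable]
  have hae : ∀ᵐ x ∂Measure.pi fun _ : Fin n => ρ,
      cexp ((∫ y, g y ∂(ofTuple x).1 : ℝ) * I) = ∏ i, cexp (g (x i) * I) := by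
    filter_upwards [ae_injective_pi ρ] with x hx
    rw [integral_ofTuple hx, ofReal_sum, Finset.sum_mul, exp_sum]
  rw [integral_congr_ae hae, integral_fintype_prod_eq_pow fun x => cexp (g x * I),
    Fintype.card_fin]

lemma integral_cexp_integral_poissonLaw (r : ℝ≥0) {g : α → ℝ} (hg : Measurable g) :
    ∫ ν, cexp ((∫ x, g x ∂ν.1 : ℝ) * I) ∂poissonLaw ρ r =
      cexp (∫ x, (cexp (g x * I) - 1) ∂(r • ρ)) := by
  have hint (P : Measure (SimplePointMeasure α)) [IsProbabilityMeasure P] :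
      Integrable (fun ν : SimplePointMeasure α => cexp ((∫ x, g x ∂ν.1 : ℝ) * I)) P :=
    .of_bound (measurable_cexp_integral hg).aestronglyMeasurable 1 (by simp [norm_exp_ofReal_mul_I])
  have hintg : Integrable (fun x => cexp (g x * I)) ρ :=
    .of_bound (by fun_prop) 1 (by simp [norm_exp_ofReal_mul_I])
  rw [poissonLaw, Measure.comp_eq_comp_const_apply, Kernel.integral_comp (hint _)]
  simp only [Kernel.const_apply, integral_cexp_integral_iidLaw _ hg, integral_pow_poissonMeasure]
  rw [integral_smul_nnreal_measure, integral_sub hintg (integrable_const 1)]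
  simp [NNReal.smul_def]

theorem isPoissonProcess_of_map_eq_poissonLaw {Ω : Type*} [MeasurableSpace Ω] {P : Measure Ω}
    [IsProbabilityMeasure P] {N : Ω → SimplePointMeasure α} (hN : Measurable N) {r : ℝ≥0}
    (h : P.map N = poissonLaw ρ r) : IsPoissonProcess (r • ρ) N P := by
  refine .of_charFunctional hN fun g hg => ?_
  rw [← integral_cexp_integral_poissonLaw r hg, ← h,
    integral_map hN.aemeasurable (measurable_cexp_integral hg).aestronglyMeasurable]

end PoissonLaw

section ProbabilityIntegralTransform

open Filter Topology

variable {μ : Measure ℝ} [IsProbabilityMeasure μ] [NullSingletonClass μ]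

lemma continuous_cdf : Continuous (cdf μ) := by
  refine continuous_iff_continuousAt.2 fun x => ?_
  rw [(monotone_cdf μ).continuousAt_iff_leftLim_eq_rightLim, StieltjesFunction.rightLim_eq]
  have hjump := (cdf μ).measure_singleton x
  rw [measure_cdf, measure_singleton, eq_comm, ENNReal.ofReal_eq_zero] at hjump
  exact le_antisymm ((monotone_cdf μ).leftLim_le le_rfl) (by linarith)

lemma measure_setOf_cdf_le (t : unitInterval) : μ {x | cdf μ x ≤ t} = ENNReal.ofReal t := by
  obtain ht | ht := t.2.2.eq_or_lt
  · simp [ht, cdf_le_one]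
  have hbdd : BddAbove {x | cdf μ x ≤ t} := by
    obtain ⟨b, hb⟩ := ((tendsto_cdf_atTop μ).eventually (lt_mem_nhds ht)).exists
    exact ⟨b, fun x hx => ((monotone_cdf μ).reflect_lt (lt_of_le_of_lt hx hb)).le⟩
  obtain hempty | hne := {x | cdf μ x ≤ t}.eq_empty_or_nonempty
  · have ht0 : (t : ℝ) ≤ 0 := ge_of_tendsto (tendsto_cdf_atBot μ) <| .of_forall fun x =>
      (not_le.1 (Set.eq_empty_iff_forall_notMem.1 hempty x)).le
    rw [hempty, measure_empty, ENNReal.ofReal_of_nonpos ht0]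
  set c := sSup {x | cdf μ x ≤ t}
  have hc : cdf μ c ≤ t := (isClosed_le continuous_cdf continuous_const).csSup_mem hne hbdd
  have hset : {x | cdf μ x ≤ t} = Set.Iic c :=
    Set.ext fun x => ⟨fun hx => le_csSup hbdd hx, fun hx => (monotone_cdf μ hx).trans hc⟩
  have htc : t ≤ cdf μ c := by
    refine ge_of_tendsto (continuous_cdf.continuousWithinAt (s := Set.Ioi c)) ?_
    filter_upwards [self_mem_nhdsWithin] with y hy
    exact (not_le.1 fun hyt => hy.not_ge (le_csSup hbdd hyt)).le
  rw [hset, ← ofReal_cdf, hc.antisymm htc]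

lemma map_codRestrict_cdf :
    μ.map (Set.codRestrict (cdf μ) unitInterval fun x => ⟨cdf_nonneg μ x, cdf_le_one μ x⟩) =
      volume := by
  have hmeas : Measurable
      (Set.codRestrict (cdf μ) unitInterval fun x => ⟨cdf_nonneg μ x, cdf_le_one μ x⟩) :=
    continuous_cdf.measurable.subtype_mk
  have := Measure.isProbabilityMeasure_map (μ := μ) hmeas.aemeasurable
  refine Measure.ext_of_Iic _ _ fun t => ?_
  rw [Measure.map_apply hmeas measurableSet_Iic, unitInterval.volume_Iic]
  exact measure_setOf_cdf_le t

end ProbabilityIntegralTransform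

theorem exists_measurable_map_eq {α β : Type*} [MeasurableSpace α] [StandardBorelSpace α]
    [MeasurableSpace β] [StandardBorelSpace β] (ρ : Measure α) [IsProbabilityMeasure ρ]
    [NullSingletonClass ρ] (κ : Measure β) [IsProbabilityMeasure κ] :
    ∃ g : α → β, Measurable g ∧ ρ.map g = κ := by
  have : Nonempty β := κ.nonempty_of_neZero
  obtain ⟨g, hg, hgκ⟩ := κ.exists_measurable_map_eq
  have he := measurableEmbedding_embeddingReal α
  have : IsProbabilityMeasure (ρ.map (embeddingReal α)) :=
    Measure.isProbabilityMeasure_map he.measurable.aemeasurable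
  have : NullSingletonClass (ρ.map (embeddingReal α)) := ⟨fun x => by
    rw [he.map_apply]
    exact (Set.subsingleton_singleton.preimage he.injective).measure_zero ρ⟩
  have hcdf : Measurable (Set.codRestrict (cdf (ρ.map (embeddingReal α))) unitInterval
      fun x => ⟨cdf_nonneg _ x, cdf_le_one _ x⟩) := continuous_cdf.measurable.subtype_mk
  refine ⟨_, hg.comp (hcdf.comp he.measurable), ?_⟩
  rw [← Measure.map_map hg (hcdf.comp he.measurable), ← Measure.map_map hcdf he.measurable,
    map_codRestrict_cdf, hgκ]

section UniformSum

variable {α β G : Type*} [MeasurableSpace α] [MeasurableSpace β] [AddCommGroup G]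
  [MeasurableSpace G] [MeasurableAdd₂ G] {ρ : Measure α} [IsProbabilityMeasure ρ] {μ : Measure G}
  [IsProbabilityMeasure μ] [μ.IsAddLeftInvariant] {κ : Measure β} [IsProbabilityMeasure κ]
  {a : α → G} {V : α → β}

lemma measurePreserving_sum_removeNth
    (haV : MeasurePreserving (fun x => (a x, V x)) ρ (μ.prod κ)) {n : ℕ} (j : Fin (n + 1)) :
    MeasurePreserving (fun x : Fin (n + 1) → α => (∑ i, a (x i), V (x j), j.removeNth x))
      (Measure.pi fun _ => ρ) (μ.prod (κ.prod (Measure.pi fun _ => ρ))) := by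
  have ha : Measurable a := haV.measurable.fst
  have hV : Measurable V := haV.measurable.snd
  have hskew : MeasurePreserving
      (fun p : (Fin n → α) × α => (p.1, a p.2 + ∑ i, a (p.1 i), V p.2))
      ((Measure.pi fun _ => ρ).prod ρ) ((Measure.pi fun _ => ρ).prod (μ.prod κ)) :=
    (MeasurePreserving.id (Measure.pi fun _ => ρ)).skew_product
      (g := fun z y => (a y + ∑ i, a (z i), V y)) (by unfold Function.uncurry; fun_prop)
      (.of_forall fun z => (((measurePreserving_add_right μ _).prod (.id κ)).comp haV).map_eq)
  have hcomp := (measurePreserving_prodAssoc _ _ _).comp <| Measure.measurePreserving_swap.comp <|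
    hskew.comp <| Measure.measurePreserving_swap.comp <|
      measurePreserving_piFinSuccAbove (fun _ => ρ) j
  convert hcomp using 1
  exact funext fun x => Prod.ext (Fin.sum_univ_succAbove _ j) rfl

lemma indepFun_sum_removeNth
    (haV : MeasurePreserving (fun x => (a x, V x)) ρ (μ.prod κ)) {n : ℕ} (j : Fin (n + 1)) :
    IndepFun (fun x : Fin (n + 1) → α => ∑ i, a (x i)) (fun x => (V (x j), j.removeNth x))
      (Measure.pi fun _ => ρ) := by
  have h := measurePreserving_sum_removeNth haV j
  refine (indepFun_iff_map_prod_eq_prod_map_map h.measurable.fst.aemeasurable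
    h.measurable.snd.aemeasurable).2 (h.map_eq.trans ?_)
  congr 1
  · exact (measurePreserving_fst.comp h).map_eq.symm
  · exact (measurePreserving_snd.comp h).map_eq.symm

lemma measurePreserving_sum
    (haV : MeasurePreserving (fun x => (a x, V x)) ρ (μ.prod κ)) {n : ℕ} [NeZero n] :
    MeasurePreserving (fun x : Fin n → α => ∑ i, a (x i)) (Measure.pi fun _ => ρ) μ := by
  obtain ⟨m, rfl⟩ := Nat.exists_eq_succ_of_ne_zero (NeZero.ne n)
  exact measurePreserving_fst.comp (measurePreserving_sum_removeNth haV 0)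

end UniformSum

section Selection

lemma measure_setOf_eq_and_mem_of_indepFun {Ω γ δ : Type*} [MeasurableSpace Ω] [MeasurableSpace γ]
    [MeasurableSpace δ] [MeasurableEq δ] {P : Measure Ω} [IsFiniteMeasure P] {Z : Ω → δ}
    {Y : Ω → γ} {T : γ → δ} (hindep : IndepFun Z Y P) (hZ : Measurable Z) (hY : Measurable Y)
    (hT : Measurable T) {c : ℝ≥0∞} (hc : ∀ y, P (Z ⁻¹' {T y}) = c) {F : Set γ}
    (hF : MeasurableSet F) : P {ω | Z ω = T (Y ω) ∧ Y ω ∈ F} = c * P (Y ⁻¹' F) := by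
  have hD : MeasurableSet {p : δ × γ | p.1 = T p.2 ∧ p.2 ∈ F} :=
    (measurableSet_eq_fun measurable_fst (hT.comp measurable_snd)).inter (measurable_snd hF)
  have hslice (y : γ) : P.map Z ((fun z => (z, y)) ⁻¹' {p : δ × γ | p.1 = T p.2 ∧ p.2 ∈ F}) =
      F.indicator (fun _ => c) y := by
    by_cases hy : y ∈ F
    · simp [hy, ← hc y, Measure.map_apply hZ]
    · simp [hy]
  calc P {ω | Z ω = T (Y ω) ∧ Y ω ∈ F}
      = P.map (fun ω => (Z ω, Y ω)) {p | p.1 = T p.2 ∧ p.2 ∈ F} :=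
        (Measure.map_apply (hZ.prodMk hY) hD).symm
    _ = ((P.map Z).prod (P.map Y)) {p | p.1 = T p.2 ∧ p.2 ∈ F} := by
        rw [(indepFun_iff_map_prod_eq_prod_map_map hZ.aemeasurable hY.aemeasurable).1 hindep]
    _ = c * P (Y ⁻¹' F) := by
        rw [Measure.prod_apply_symm hD]
        simp only [hslice]
        rw [lintegral_indicator_const hF, Measure.map_apply hY hF]

lemma measurable_tuple_sort {n : ℕ} :
    Measurable[_, ⊤] (Tuple.sort : (Fin n → ℝ) → Equiv.Perm (Fin n)) := by
  let _ : MeasurableSpace (Equiv.Perm (Fin n)) := ⊤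
  refine measurable_to_countable' fun σ => ?_
  have hset : Tuple.sort ⁻¹' {σ} = {u : Fin n → ℝ |
      (∀ i j, i ≤ j → u (σ i) ≤ u (σ j)) ∧ ∀ i j, i < j → u (σ i) = u (σ j) → σ i < σ j} := by
    ext u
    exact eq_comm.trans Tuple.eq_sort_iff
  rw [hset]
  measurability

variable {α G : Type*} [AddCommGroup G]

/-- The set of indices `i` for which the rank of `V (x i)` among `V (x 0), …, V (x (n - 1))`
belongs to the subset `S (∑ i, a (x i))` of `{0, …, n - 1}`. -/
noncomputable def selection {n : ℕ} (a : α → G) (V : α → ℝ) (S : G → Finset (Fin n))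
    (x : Fin n → α) : Finset (Fin n) :=
  (S (∑ i, a (x i))).map (Tuple.sort (V ∘ x)).toEmbedding

lemma selection_eq_iff {n : ℕ} {a : α → G} {V : α → ℝ} {S : G → Finset (Fin n)} {x : Fin n → α}
    {K : Finset (Fin n)} :
    selection a V S x = K ↔ S (∑ i, a (x i)) = K.map (Tuple.sort (V ∘ x)).symm.toEmbedding := by
  rw [selection, ← Finset.map_inj (f := (Tuple.sort (V ∘ x)).symm.toEmbedding), Finset.map_map]
  simp

variable [MeasurableSpace α] [MeasurableSpace G] [MeasurableAdd₂ G] {a : α → G} {V : α → ℝ}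

lemma measurable_selection (ha : Measurable a) (hV : Measurable V) {n : ℕ}
    {S : G → Finset (Fin n)} (hS : Measurable S) : Measurable (selection a V S) := by
  let _ : MeasurableSpace (Equiv.Perm (Fin n)) := ⊤
  have hsort : Measurable fun x : Fin n → α => Tuple.sort (V ∘ x) :=
    measurable_tuple_sort.comp (measurable_pi_lambda _ fun i => hV.comp (measurable_pi_apply i))
  have hsum : Measurable fun x : Fin n → α => S (∑ i, a (x i)) := by fun_prop
  exact (Measurable.of_discrete (f := fun p : Finset (Fin n) × Equiv.Perm (Fin n) =>
    p.1.map p.2.toEmbedding)).comp (hsum.prodMk hsort)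

variable {ρ : Measure α} [IsProbabilityMeasure ρ] {μ : Measure G}
  [IsProbabilityMeasure μ] [μ.IsAddLeftInvariant] {κ : Measure ℝ} [IsProbabilityMeasure κ]

/-- The sum of all the labels is independent of all but one of the points together with the ranks
of all of them. -/
lemma measure_selection_eq_and_removeNth_mem
    (haV : MeasurePreserving (fun x => (a x, V x)) ρ (μ.prod κ)) {n : ℕ}
    {S : G → Finset (Fin (n + 1))} (hS : Measurable S) {K : Finset (Fin (n + 1))} {c : ℝ≥0∞}
    (hc : ∀ T : Finset (Fin (n + 1)), T.card = K.card → μ (S ⁻¹' {T}) = c) (j : Fin (n + 1))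
    {E : Set (Fin n → α)} (hE : MeasurableSet E) :
    Measure.pi (fun _ => ρ) {x | selection a V S x = K ∧ j.removeNth x ∈ E} =
      c * Measure.pi (fun _ => ρ) E := by
  have hV : Measurable V := haV.measurable.snd
  have hjoint := measurePreserving_sum_removeNth haV j
  have hsum := measurePreserving_sum (n := n + 1) haV
  let u (y : ℝ × (Fin n → α)) : Fin (n + 1) → ℝ := j.insertNth y.1 (V ∘ y.2)
  have hVtail : Measurable fun y : ℝ × (Fin n → α) => (y.1, fun l => V (y.2 l)) := by fun_prop
  have hu : Measurable u :=
    (MeasurableEquiv.piFinSuccAbove (fun _ => ℝ) j).symm.measurable.comp hVtail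
  have huV (x : Fin (n + 1) → α) : u (V (x j), j.removeNth x) = V ∘ x :=
    Fin.insertNth_self_removeNth (α := fun _ => ℝ) j (V ∘ x)
  let T (y : ℝ × (Fin n → α)) : Finset (Fin (n + 1)) := K.map (Tuple.sort (u y)).symm.toEmbedding
  have hT : Measurable T := (measurable_from_top (f := fun σ : Equiv.Perm (Fin (n + 1)) =>
    K.map σ.symm.toEmbedding)).comp (measurable_tuple_sort.comp hu)
  have hprob (y : ℝ × (Fin n → α)) :
      Measure.pi (fun _ => ρ) ((fun x => S (∑ i, a (x i))) ⁻¹' {T y}) = c :=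
    (hsum.measure_preimage (hS (measurableSet_singleton _)).nullMeasurableSet).trans
      (hc _ (K.card_map _))
  calc Measure.pi (fun _ => ρ) {x | selection a V S x = K ∧ j.removeNth x ∈ E}
      = Measure.pi (fun _ => ρ) {x : Fin (n + 1) → α | S (∑ i, a (x i)) =
          T (V (x j), j.removeNth x) ∧ j.removeNth x ∈ E} := by
        simp only [selection_eq_iff, T, huV]
    _ = c * Measure.pi (fun _ => ρ) (j.removeNth ⁻¹' E) :=
        measure_setOf_eq_and_mem_of_indepFun ((indepFun_sum_removeNth haV j).comp hS measurable_id)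
          (hS.comp hsum.measurable) hjoint.measurable.snd hT hprob (measurable_snd hE)
    _ = c * Measure.pi (fun _ => ρ) E := by
        congr 1
        exact ((measurePreserving_snd.comp measurePreserving_snd).comp hjoint).measure_preimage
          hE.nullMeasurableSet

lemma measure_selection_eq_and_comp_mem
    (haV : MeasurePreserving (fun x => (a x, V x)) ρ (μ.prod κ)) {n : ℕ}
    {S : G → Finset (Fin n)} (hS : Measurable S) {K : Finset (Fin n)} {c : ℝ≥0∞}
    (hc : ∀ T : Finset (Fin n), T.card = K.card → μ (S ⁻¹' {T}) = c) {ι : Type*} [Fintype ι]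
    {e : ι → Fin n} (he : Function.Injective e) (hrange : ¬ Function.Surjective e)
    {E : Set (ι → α)} (hE : MeasurableSet E) :
    Measure.pi (fun _ => ρ) {x | selection a V S x = K ∧ x ∘ e ∈ E} =
      c * Measure.pi (fun _ => ρ) E := by
  obtain ⟨j, hj⟩ := not_forall.1 hrange
  obtain _ | m := n
  · exact j.elim0
  have hskip (i : ι) : ∃ l, j.succAbove l = e i :=
    Fin.exists_succAbove_eq fun h => hj ⟨i, h⟩
  choose e' he' using hskip
  have he'_inj : Function.Injective e' := fun k l hkl => he (by rw [← he', ← he', hkl])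
  have hmp := measurePreserving_comp_of_injective ρ he'_inj
  rw [← hmp.measure_preimage hE.nullMeasurableSet,
    ← measure_selection_eq_and_removeNth_mem haV hS hc j (hmp.measurable hE)]
  have hcomp (x : Fin (m + 1) → α) : j.removeNth x ∘ e' = x ∘ e :=
    funext fun i => congrArg x (he' i)
  simp only [Set.mem_preimage, hcomp]

lemma measure_selection_eq_univ_and_mem
    (haV : MeasurePreserving (fun x => (a x, V x)) ρ (μ.prod κ)) {n : ℕ}
    {S : G → Finset (Fin n)} (hS : Measurable S) {c : ℝ≥0∞}
    (hc : μ (S ⁻¹' {Finset.univ}) = c) (hc01 : c = 0 ∨ c = 1) (E : Set (Fin n → α)) :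
    Measure.pi (fun _ => ρ) {x | selection a V S x = Finset.univ ∧ x ∈ E} =
      c * Measure.pi (fun _ => ρ) E := by
  have hsel (x : Fin n → α) : selection a V S x = Finset.univ ↔ S (∑ i, a (x i)) = Finset.univ := by
    rw [selection_eq_iff, Finset.map_univ_equiv]
  simp only [hsel]
  obtain rfl | hn := eq_or_ne n 0
  · have hS' (s : G) : S s = Finset.univ := Subsingleton.elim _ _
    have hc1 : c = 1 := by simp [← hc, Set.preimage, hS']
    simp [hS', hc1]
  have : NeZero n := ⟨hn⟩
  have hU := (measurePreserving_sum (n := n) haV).measure_preimage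
    (hS (measurableSet_singleton Finset.univ)).nullMeasurableSet
  rw [hc] at hU
  obtain rfl | rfl := hc01
  · rw [zero_mul]
    exact measure_mono_null (fun x hx => hx.1) hU
  · rw [one_mul]
    have hU' := (mem_ae_iff_prob_eq_one (hS.comp (measurePreserving_sum (n := n) haV).measurable
      (measurableSet_singleton Finset.univ))).2 hU
    refine measure_congr (Filter.eventuallyEq_set.2 ?_)
    filter_upwards [hU'] with x hx using and_iff_right hx

lemma measure_selection_eq_and_orderEmbOfFin_mem
    (haV : MeasurePreserving (fun x => (a x, V x)) ρ (μ.prod κ)) {n : ℕ}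
    {S : G → Finset (Fin n)} (hS : Measurable S) {K : Finset (Fin n)} {c : ℝ≥0∞}
    (hc : ∀ T : Finset (Fin n), T.card = K.card → μ (S ⁻¹' {T}) = c)
    (hc01 : K = Finset.univ → c = 0 ∨ c = 1) {E : Set (Fin K.card → α)} (hE : MeasurableSet E) :
    Measure.pi (fun _ => ρ) {x | selection a V S x = K ∧ x ∘ K.orderEmbOfFin rfl ∈ E} =
      c * Measure.pi (fun _ => ρ) E := by
  by_cases hK : K = Finset.univ
  · have hmp := measurePreserving_comp_of_injective ρ (K.orderEmbOfFin rfl).injective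
    rw [← hmp.measure_preimage hE.nullMeasurableSet,
      ← measure_selection_eq_univ_and_mem haV hS (hc _ (by rw [hK])) (hc01 hK)]
    simp only [Set.mem_preimage, ← hK]
  · refine measure_selection_eq_and_comp_mem haV hS hc (K.orderEmbOfFin rfl).injective
      (fun hsurj => hK ?_) hE
    rw [← Finset.coe_eq_univ, ← K.range_orderEmbOfFin rfl, hsurj.range_eq]

end Selection

lemma card_filter_lt_tuple_sort {n : ℕ} {β : Type*} [LinearOrder β] {u : Fin n → β}
    (hu : Function.Injective u) (k : Fin n) :
    (Finset.univ.filter fun l => u l < u (Tuple.sort u k)).card = k := by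
  have hmono : StrictMono (u ∘ Tuple.sort u) :=
    (Tuple.monotone_sort u).strictMono_of_injective (hu.comp (Tuple.sort u).injective)
  have hfilter : (Finset.univ.filter fun l => u l < u (Tuple.sort u k)) =
      (Finset.Iio k).map (Tuple.sort u).toEmbedding := by
    ext l
    obtain ⟨l, rfl⟩ := (Tuple.sort u).surjective l
    simpa using hmono.lt_iff_lt
  rw [hfilter, Finset.card_map, Fin.card_Iio]

namespace SimplePointMeasure

section Thin

variable {α : Type*} [MeasurableSpace α]

lemma measurable_apply_prodMk {β : Type*} [MeasurableSpace β] {g : β → SimplePointMeasure α}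
    (hg : Measurable g) {t : Set (β × α)} (ht : MeasurableSet t) :
    Measurable fun b => (g b).1 (Prod.mk b ⁻¹' t) :=
  Kernel.measurable_kernel_prodMk_left_of_finite
    (κ := ⟨fun b => (g b).1, measurable_subtype_coe.comp hg⟩) ht
    fun b => (g b).instIsFiniteMeasure

lemma restrict_ofFinset (s : Finset α) {C : Set α} [DecidablePred (· ∈ C)]
    (hC : MeasurableSet C) : (ofFinset s).1.restrict C = (ofFinset (s.filter (· ∈ C))).1 := by
  classical
  refine Measure.ext fun B hB => ?_
  rw [Measure.restrict_apply hB, ofFinset_apply _ (hB.inter hC), ofFinset_apply _ hB,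
    Finset.filter_filter]
  simp only [Set.mem_inter_iff, and_comm]

lemma exists_restrict_eq (ν : SimplePointMeasure α) {C : Set α} (hC : MeasurableSet C) :
    ∃ s : Finset α, ν.1.restrict C = ∑ x ∈ s, Measure.dirac x := by
  classical
  obtain ⟨s, rfl⟩ := ν.exists_eq_ofFinset
  exact ⟨_, restrict_ofFinset s hC⟩

/-- The sum, in the circle `ℝ / ℤ`, of the labels `A x` of the points `x` of `ν`. -/
noncomputable def labelSum (A : α → ℝ) (ν : SimplePointMeasure α) : UnitAddCircle :=
  (∫ x, A x ∂ν.1 : ℝ)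

/-- The points retained by the thinning: those whose rank, with respect to `V`, belongs to the
subset `φ n s` of `{0, …, n - 1}`, where `n` is the number of points and `s` the sum of their
labels. -/
def retained (A V : α → ℝ) (φ : (n : ℕ) → UnitAddCircle → Finset (Fin n))
    (ν : SimplePointMeasure α) : Set α :=
  {x | ∃ n, ∃ k ∈ φ n (labelSum A ν), ν.1 Set.univ = n ∧ ν.1 {y | V y < V x} = k.val}

variable {A V : α → ℝ} {φ : (n : ℕ) → UnitAddCircle → Finset (Fin n)}

lemma measurable_labelSum [MeasurableSingletonClass α] (hA : Measurable A) :
    Measurable (labelSum A) :=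
  AddCircle.measurable_mk'.comp (measurable_integral hA)

variable [MeasurableSingletonClass α]

lemma measurableSet_setOf_mem_retained (hA : Measurable A) (hV : Measurable V)
    (hφ : ∀ n, Measurable (φ n)) :
    MeasurableSet {p : SimplePointMeasure α × α | p.2 ∈ retained A V φ p.1} := by
  have hset : {p : SimplePointMeasure α × α | p.2 ∈ retained A V φ p.1} = ⋃ n, ⋃ k : Fin n,
      {p | k ∈ φ n (labelSum A p.1)} ∩
        ({p | p.1.1 Set.univ = (n : ℝ≥0∞)} ∩ {p | p.1.1 {y | V y < V p.2} = (k.val : ℝ≥0∞)}) := by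
    ext p
    simp [retained]
  rw [hset]
  refine .iUnion fun n => .iUnion fun k => .inter ?_ (.inter ?_ ?_)
  · exact ((hφ n).comp ((measurable_labelSum hA).comp measurable_fst)) (measurableSet_mem_finset k)
  · exact ((measurable_apply .univ).comp measurable_fst) (measurableSet_singleton _)
  · exact measurable_apply_prodMk (t := {q : (SimplePointMeasure α × α) × α | V q.2 < V q.1.2})
      measurable_fst (measurableSet_lt (by fun_prop) (by fun_prop)) (measurableSet_singleton _)

lemma measurableSet_retained (hA : Measurable A) (hV : Measurable V) (hφ : ∀ n, Measurable (φ n))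
    (ν : SimplePointMeasure α) : MeasurableSet (retained A V φ ν) :=
  measurable_prodMk_left (measurableSet_setOf_mem_retained hA hV hφ)

/-- The thinning that retains the points of `retained A V φ ν`. -/
noncomputable def thin (hA : Measurable A) (hV : Measurable V) (hφ : ∀ n, Measurable (φ n))
    (ν : SimplePointMeasure α) : SimplePointMeasure α :=
  ⟨ν.1.restrict (retained A V φ ν), ν.exists_restrict_eq (measurableSet_retained hA hV hφ ν)⟩

variable (hA : Measurable A) (hV : Measurable V) (hφ : ∀ n, Measurable (φ n))

lemma measurable_thin : Measurable (thin hA hV hφ) := by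
  refine Measurable.subtype_mk (Measure.measurable_of_measurable_coe _ fun B hB => ?_)
  simp_rw [Measure.restrict_apply hB]
  exact measurable_apply_prodMk measurable_id
    (t := {p : SimplePointMeasure α × α | p.2 ∈ B ∩ retained A V φ p.1})
    ((measurable_snd hB).inter (measurableSet_setOf_mem_retained hA hV hφ))

lemma points_thin_subset (ν : SimplePointMeasure α) :
    (thin hA hV hφ ν).points ⊆ ν.points := by
  intro x hx
  have hx' : ν.1.restrict (retained A V φ ν) {x} = 1 := hx
  rw [Measure.restrict_apply (measurableSet_singleton x)] at hx'
  have hmem : ({x} ∩ retained A V φ ν).Nonempty :=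
    nonempty_of_measure_ne_zero (hx' ▸ one_ne_zero)
  rwa [Set.inter_eq_left.2 (Set.singleton_subset_iff.2 (Set.singleton_inter_nonempty.1 hmem))]
    at hx'

lemma labelSum_ofTuple {ι : Type*} [Fintype ι] {x : ι → α} (hx : Function.Injective x) :
    labelSum A (ofTuple x) = ∑ i, (A (x i) : UnitAddCircle) := by
  rw [labelSum, integral_ofTuple hx]
  exact map_sum (QuotientAddGroup.mk' _) _ _

include hV in
lemma mem_retained_ofTuple_iff {n : ℕ} {x : Fin n → α} (hx : Function.Injective (V ∘ x))
    (i : Fin n) :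
    x i ∈ retained A V φ (ofTuple x) ↔
      i ∈ selection (fun y => (A y : UnitAddCircle)) V (φ n) x := by
  classical
  obtain ⟨k, rfl⟩ := (Tuple.sort (V ∘ x)).surjective i
  have hrank : (ofTuple x).1 {y | V y < V (x (Tuple.sort (V ∘ x) k))} = k.val := by
    rw [ofTuple_eq_ofFinset hx.of_comp, ofFinset_apply _ (measurableSet_lt hV measurable_const),
      Finset.filter_map, Finset.card_map]
    exact congrArg _ (card_filter_lt_tuple_sort hx k)
  have hcard : (ofTuple x).1 Set.univ = n := by
    simp [ofTuple_eq_ofFinset hx.of_comp, ofFinset_apply_univ]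
  have hselection : Tuple.sort (V ∘ x) k ∈ selection (fun y => (A y : UnitAddCircle)) V (φ n) x ↔
      k ∈ φ n (labelSum A (ofTuple x)) := by
    rw [labelSum_ofTuple hx.of_comp]
    exact Finset.mem_map' _
  rw [hselection]
  constructor
  · rintro ⟨m, l, hl, hm, hkl⟩
    obtain rfl : n = m := by exact_mod_cast hcard.symm.trans hm
    obtain rfl : k = l := Fin.ext (by exact_mod_cast hrank.symm.trans hkl)
    exact hl
  · exact fun hk => ⟨n, k, hk, hcard, hrank⟩

lemma thin_ofTuple {n : ℕ} {x : Fin n → α} (hx : Function.Injective (V ∘ x)) :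
    thin hA hV hφ (ofTuple x) = ofTuple
      (x ∘ (selection (fun y => (A y : UnitAddCircle)) V (φ n) x).orderEmbOfFin rfl) := by
  classical
  set K := selection (fun y => (A y : UnitAddCircle)) V (φ n) x
  have hcomp : Function.Injective (x ∘ K.orderEmbOfFin rfl) :=
    hx.of_comp.comp (K.orderEmbOfFin rfl).injective
  have hfilter : (Finset.univ.map ⟨x, hx.of_comp⟩).filter (· ∈ retained A V φ (ofTuple x)) =
      Finset.univ.map ⟨x ∘ K.orderEmbOfFin rfl, hcomp⟩ := by
    have hK : Finset.univ.filter (fun i => x i ∈ retained A V φ (ofTuple x)) = K := by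
      ext i
      simp [K, mem_retained_ofTuple_iff hV hx]
    calc _ = K.map ⟨x, hx.of_comp⟩ := by rw [Finset.filter_map, ← hK]; rfl
      _ = _ := by
        conv_lhs => rw [← K.map_orderEmbOfFin_univ rfl, Finset.map_map]
        rfl
  refine Subtype.ext ?_
  rw [ofTuple_eq_ofFinset hcomp, ← hfilter,
    ← restrict_ofFinset _ (measurableSet_retained hA hV hφ _), ← ofTuple_eq_ofFinset hx.of_comp]
  rfl

end Thin

end SimplePointMeasure

section RandomSubset

lemma lintegral_eq_sum_range {p : Measure ℕ} {n : ℕ} (hp : ∀ k, n < k → p {k} = 0)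
    (f : ℕ → ℝ≥0∞) : ∫⁻ k, f k ∂p = ∑ k ∈ Finset.range (n + 1), f k * p {k} := by
  rw [lintegral_countable']
  refine tsum_eq_sum fun k hk => ?_
  rw [hp k (by grind), mul_zero]

lemma sum_powerset_div_choose_card_mul {n : ℕ} (w f : ℕ → ℝ≥0∞) :
    ∑ T : Finset (Fin n), w T.card / n.choose T.card * f T.card =
      ∑ k ∈ Finset.range (n + 1), f k * w k := by
  rw [← Finset.powerset_univ,
    Finset.sum_powerset_apply_card (fun k => w k / n.choose k * f k), Finset.card_fin]
  refine Finset.sum_congr rfl fun k hk => ?_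
  have hchoose : (n.choose k : ℝ≥0∞) ≠ 0 := by
    exact_mod_cast (Nat.choose_pos (Nat.lt_succ_iff.1 (Finset.mem_range.1 hk))).ne'
  rw [nsmul_eq_mul, ← mul_assoc, ENNReal.mul_div_cancel hchoose (ENNReal.natCast_ne_top _),
    mul_comm]

lemma exists_measurable_finset_uniform_given_card {Ω : Type*} [MeasurableSpace Ω]
    [StandardBorelSpace Ω] (μ : Measure Ω) [IsProbabilityMeasure μ] [NullSingletonClass μ] {n : ℕ}
    (p : Measure ℕ) [IsProbabilityMeasure p] (hp : ∀ k, n < k → p {k} = 0) :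
    ∃ S : Ω → Finset (Fin n), Measurable S ∧
      ∀ T, μ (S ⁻¹' {T}) = p {T.card} / n.choose T.card := by
  have hsum : ∑ T : Finset (Fin n), p {T.card} / n.choose T.card = 1 := by
    calc _ = ∑ k ∈ Finset.range (n + 1), 1 * p {k} := by
          simpa using sum_powerset_div_choose_card_mul (n := n) (fun k => p {k}) (fun _ => 1)
      _ = 1 := by rw [← lintegral_eq_sum_range hp]; simp
  obtain ⟨S, hS, hlaw⟩ := exists_measurable_map_eq μ (PMF.ofFintype _ hsum).toMeasure
  refine ⟨S, hS, fun T => ?_⟩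
  rw [← Measure.map_apply hS (measurableSet_singleton T), hlaw,
    PMF.toMeasure_apply_singleton _ _ (measurableSet_singleton T), PMF.ofFintype_apply]

end RandomSubset

section Circle

instance instIsProbabilityMeasureUnitAddCircle :
    IsProbabilityMeasure (volume : Measure UnitAddCircle) :=
  ⟨UnitAddCircle.measure_univ⟩

instance instNullSingletonClassUnitAddCircle :
    NullSingletonClass (volume : Measure UnitAddCircle) := by
  have : Nontrivial UnitAddCircle := ⟨⟨((1 / 2 : ℝ) : UnitAddCircle), 0, fun h => by
    rw [AddCircle.coe_eq_zero_iff_of_mem_Ico (by norm_num)] at h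
    norm_num at h⟩⟩
  infer_instance

lemma exists_measurePreserving_circle_prod {α : Type*} [MeasurableSpace α]
    [StandardBorelSpace α] (ρ : Measure α) [IsProbabilityMeasure ρ] [NullSingletonClass ρ]
    {β : Type*} [MeasurableSpace β]
    [StandardBorelSpace β] (κ : Measure β) [IsProbabilityMeasure κ] :
    ∃ (A : α → ℝ) (V : α → β), Measurable A ∧
      MeasurePreserving (fun x => ((A x : UnitAddCircle), V x)) ρ (volume.prod κ) := by
  have hcircle := UnitAddCircle.measurePreserving_mk 0
  have : IsProbabilityMeasure ((volume : Measure ℝ).restrict (Set.Ioc 0 (0 + 1))) := ⟨by simp⟩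
  obtain ⟨g, hg, hlaw⟩ := exists_measurable_map_eq ρ
    ((volume.restrict (Set.Ioc 0 (0 + 1)) : Measure ℝ).prod κ)
  exact ⟨fun x => (g x).1, fun x => (g x).2, hg.fst, (hcircle.prod (.id κ)).comp ⟨hg, hlaw⟩⟩

end Circle

lemma ae_injective_comp_pi {ι β γ : Type*} [Fintype ι] [MeasurableSpace β] [MeasurableSpace γ]
    [MeasurableEq γ] {μ : Measure β} {ν : Measure γ}
    [IsProbabilityMeasure ν] [NullSingletonClass ν] {f : β → γ} (hf : MeasurePreserving f μ ν) :
    ∀ᵐ x ∂Measure.pi fun _ : ι => μ, Function.Injective (f ∘ x) :=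
  (measurePreserving_pi (fun _ => μ) (fun _ => ν) fun _ => hf).quasiMeasurePreserving.ae
    (ae_injective_pi ν)

namespace SimplePointMeasure

variable {α : Type*} [MeasurableSpace α] [MeasurableEq α] {ρ : Measure α} [IsProbabilityMeasure ρ]
  {κ : Measure ℝ} [IsProbabilityMeasure κ] [NullSingletonClass κ] {A V : α → ℝ}
  {φ : (n : ℕ) → UnitAddCircle → Finset (Fin n)}

lemma map_thin_iidLaw_apply
    (haV : MeasurePreserving (fun x => ((A x : UnitAddCircle), V x)) ρ (volume.prod κ))
    (hA : Measurable A) (hV : Measurable V) (hφ : ∀ n, Measurable (φ n)) {n : ℕ} {c : ℕ → ℝ≥0∞}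
    (hc : ∀ T, volume (φ n ⁻¹' {T}) = c T.card) (hc01 : c n = 0 ∨ c n = 1)
    {E : Set (SimplePointMeasure α)} (hE : MeasurableSet E) :
    (iidLaw ρ n).map (thin hA hV hφ) E =
      ∑ K : Finset (Fin n), c K.card * iidLaw ρ K.card E := by
  let sel : (Fin n → α) → Finset (Fin n) := selection (fun y => (A y : UnitAddCircle)) V (φ n)
  let F (K : Finset (Fin n)) : Set (Fin n → α) := {x | ofTuple (x ∘ K.orderEmbOfFin rfl) ∈ E}
  have hF (K) : MeasurableSet (F K) := measurable_ofTuple.comp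
    (measurable_pi_lambda _ fun i => measurable_pi_apply (K.orderEmbOfFin rfl i)) hE
  have hsel : Measurable sel := measurable_selection haV.measurable.fst hV (hφ n)
  have hthin : ∀ᵐ x ∂Measure.pi fun _ : Fin n => ρ,
      thin hA hV hφ (ofTuple x) ∈ E ↔ x ∈ ⋃ K, sel ⁻¹' {K} ∩ F K := by
    filter_upwards [ae_injective_comp_pi (measurePreserving_snd.comp haV)] with x hx
    rw [thin_ofTuple hA hV hφ hx]
    simp [sel, F]
  calc (iidLaw ρ n).map (thin hA hV hφ) E
      = Measure.pi (fun _ => ρ) {x : Fin n → α | thin hA hV hφ (ofTuple x) ∈ E} := by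
        rw [iidLaw_apply, Measure.map_map (measurable_thin hA hV hφ) measurable_ofTuple,
          Measure.map_apply ((measurable_thin hA hV hφ).comp measurable_ofTuple) hE]
        rfl
    _ = Measure.pi (fun _ => ρ) (⋃ K, sel ⁻¹' {K} ∩ F K) :=
        measure_congr (Filter.eventuallyEq_set.2 hthin)
    _ = ∑ K, Measure.pi (fun _ => ρ) (sel ⁻¹' {K} ∩ F K) := by
        rw [measure_iUnion _ fun K => (hsel (measurableSet_singleton K)).inter (hF K), tsum_fintype]
        exact fun K L hKL => ((Set.disjoint_singleton.2 hKL).preimage sel).mono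
          Set.inter_subset_left Set.inter_subset_left
    _ = ∑ K : Finset (Fin n), c K.card * iidLaw ρ K.card E := by
        refine Finset.sum_congr rfl fun K _ => ?_
        rw [iidLaw_apply, Measure.map_apply measurable_ofTuple hE]
        exact measure_selection_eq_and_orderEmbOfFin_mem haV (hφ n) (fun T hT => by rw [hc, hT])
          (fun hK => by rwa [hK, Finset.card_fin]) (measurable_ofTuple hE)

lemma map_thin_iidLaw
    (haV : MeasurePreserving (fun x => ((A x : UnitAddCircle), V x)) ρ (volume.prod κ))
    (hA : Measurable A) (hV : Measurable V) (hφ : ∀ n, Measurable (φ n)) {n : ℕ} {p : Measure ℕ}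
    (hp : ∀ k, n < k → p {k} = 0) (hp01 : p {n} = 0 ∨ p {n} = 1)
    (hφp : ∀ T, volume (φ n ⁻¹' {T}) = p {T.card} / n.choose T.card) :
    (iidLaw ρ n).map (thin hA hV hφ) = iidLaw ρ ∘ₘ p := by
  refine Measure.ext fun E hE => ?_
  rw [map_thin_iidLaw_apply (c := fun k => p {k} / n.choose k) haV hA hV hφ hφp
    (by simpa using hp01) hE,
    sum_powerset_div_choose_card_mul (fun k => p {k}) (fun k => iidLaw ρ k E),
    Measure.bind_apply hE (iidLaw ρ).aemeasurable, lintegral_eq_sum_range hp]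

end SimplePointMeasure

section Existence

variable {α : Type*} [MeasurableSpace α] [StandardBorelSpace α] {ρ : Measure α}
  [IsProbabilityMeasure ρ] [NullSingletonClass ρ]

theorem exists_measurable_thinning_map_iidLaw {w : ℕ → Measure ℕ}
    [∀ n, IsProbabilityMeasure (w n)]
    (hw : ∀ n, (∀ᵐ k ∂w n, k = n) ∨ ∀ᵐ k ∂w n, k < n) :
    ∃ f : SimplePointMeasure α → SimplePointMeasure α, Measurable f ∧
      (∀ ν, (f ν).points ⊆ ν.points) ∧ ∀ n, (iidLaw ρ n).map f = iidLaw ρ ∘ₘ w n := by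
  have hgt (n k : ℕ) (hnk : n < k) : w n {k} = 0 := by
    refine measure_mono_null (Set.singleton_subset_iff.2 ?_) (ae_iff.1 ((hw n).elim
      (fun h => h.mono fun _ => le_of_eq) fun h => h.mono fun _ => le_of_lt))
    simpa using hnk
  have hdiag (n : ℕ) : w n {n} = 0 ∨ w n {n} = 1 :=
    (hw n).symm.imp (fun h => measure_mono_null (by simp) (ae_iff.1 h))
      fun h => (prob_compl_eq_zero_iff (measurableSet_singleton n)).1 (ae_iff.1 h)
  choose φ hφ hφw using fun n =>
    exists_measurable_finset_uniform_given_card (volume : Measure UnitAddCircle) (w n) (hgt n)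
  have : IsProbabilityMeasure (volume.restrict (Set.Icc (0 : ℝ) 1)) := ⟨by simp⟩
  obtain ⟨A, V, hA, haV⟩ :=
    exists_measurePreserving_circle_prod ρ (volume.restrict (Set.Icc (0 : ℝ) 1))
  have hV : Measurable V := haV.measurable.snd
  exact ⟨SimplePointMeasure.thin hA hV hφ, SimplePointMeasure.measurable_thin hA hV hφ,
    SimplePointMeasure.points_thin_subset hA hV hφ, fun n =>
      SimplePointMeasure.map_thin_iidLaw haV hA hV hφ (hgt n) (hdiag n) (hφw n)⟩

lemma ae_condKernel_of_ae {β γ : Type*} [MeasurableSpace β] [MeasurableSingletonClass β]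
    [MeasurableSpace γ] [StandardBorelSpace γ] [Nonempty γ] {q : Measure (β × γ)}
    [IsFiniteMeasure q] {b : β} (hb : q.fst {b} ≠ 0) {p : γ → Prop}
    (h : ∀ᵐ x ∂q, x.1 = b → p x.2) : ∀ᵐ c ∂q.condKernel b, p c := by
  rw [ae_iff, Measure.condKernel_apply_of_ne_zero hb]
  refine mul_eq_zero_of_right _ (measure_mono_null ?_ (ae_iff.1 h))
  rintro ⟨_, c⟩ ⟨rfl, hc⟩
  simpa using hc

theorem poissonThinningExists_of_coupling {r s : ℝ≥0} (hr : 0 < r) {q : Measure (ℕ × ℕ)}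
    (hfst : q.fst = poissonMeasure r) (hsnd : q.snd = poissonMeasure s)
    (hq : ∀ n, (∀ᵐ x ∂q, x.1 = n → x.2 = n) ∨ ∀ᵐ x ∂q, x.1 = n → x.2 < n) :
    PoissonThinningExists (r • ρ) (s • ρ) := by
  have : IsProbabilityMeasure q := ⟨by rw [← Measure.fst_univ, hfst, measure_univ]⟩
  have hne (n : ℕ) : q.fst {n} ≠ 0 := by
    rw [hfst, poissonMeasure_singleton]
    simp only [ne_eq, ENNReal.ofReal_eq_zero, not_le]
    positivity
  obtain ⟨f, hf, hsub, hfw⟩ := exists_measurable_thinning_map_iidLaw (ρ := ρ)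
    fun n => (hq n).imp (ae_condKernel_of_ae (hne n)) (ae_condKernel_of_ae (hne n))
  have hbind : q.condKernel ∘ₘ poissonMeasure r = poissonMeasure s := by
    rw [← hfst, ← hsnd, ← Measure.snd_compProd, Measure.disintegrate]
  have hmap : (poissonLaw ρ r).map f = poissonLaw ρ s := by
    have hker : (iidLaw ρ).map f = iidLaw ρ ∘ₖ q.condKernel := by
      ext1 n
      rw [Kernel.map_apply _ hf, hfw, Kernel.comp_apply]
    rw [poissonLaw, Measure.map_comp _ _ hf, hker, ← Measure.comp_assoc, hbind, poissonLaw]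
  exact ⟨f, hf, poissonLaw ρ r, inferInstance,
    isPoissonProcess_of_map_eq_poissonLaw measurable_id Measure.map_id,
    isPoissonProcess_of_map_eq_poissonLaw hf hmap, .of_forall hsub⟩

end Existence

section NatCoupling

lemma measure_le_of_singleton_le {α : Type*} [Countable α] [MeasurableSpace α]
    [MeasurableSingletonClass α] {μ ν : Measure α} (h : ∀ x, μ {x} ≤ ν {x}) : μ ≤ ν :=
  Measure.le_iff.2 fun s hs => by
    rw [← μ.tsum_indicator_apply_singleton s hs, ← ν.tsum_indicator_apply_singleton s hs]
    exact ENNReal.tsum_le_tsum fun x => Set.indicator_le_indicator (h x)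

lemma restrict_Iio_le_of_singleton_le {μ ν : Measure ℕ} {m : ℕ} (h : ∀ n < m, μ {n} ≤ ν {n}) :
    μ.restrict (Set.Iio m) ≤ ν := measure_le_of_singleton_le fun n => by
  rw [Measure.restrict_apply (measurableSet_singleton n)]
  obtain hn | hn := lt_or_ge n m
  · exact (measure_mono Set.inter_subset_left).trans (h n hn)
  · simp [hn]

lemma restrict_Iio_add_restrict_Ici (μ : Measure ℕ) (m : ℕ) :
    μ.restrict (Set.Iio m) + μ.restrict (Set.Ici m) = μ := by
  simpa using Measure.restrict_add_restrict_compl (μ := μ) (s := Set.Iio m) measurableSet_Iio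

/-- The quantile function of a finite measure on `ℕ`, with junk value `0` for levels
`t ≥ μ univ`. -/
noncomputable def natQuantile (μ : Measure ℕ) (t : ℝ) : ℕ :=
  sInf {n | t < μ.real (Set.Iic n)}

variable {μ ν : Measure ℕ} [IsFiniteMeasure μ]

lemma exists_lt_measureReal_Iic {t : ℝ} (ht : t < μ.real Set.univ) :
    ∃ n, t < μ.real (Set.Iic n) := by
  have hlim : Filter.Tendsto (fun n => μ.real (Set.Iic n)) Filter.atTop
      (nhds (μ.real Set.univ)) := by
    rw [← Set.iUnion_Iic (α := ℕ)]
    exact (ENNReal.continuousAt_toReal (measure_ne_top _ _)).tendsto.comp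
      (tendsto_measure_iUnion_atTop fun _ _ => Set.Iic_subset_Iic.2)
  exact (hlim.eventually (lt_mem_nhds ht)).exists

lemma natQuantile_le_iff {t : ℝ} (ht : t < μ.real Set.univ) {n : ℕ} :
    natQuantile μ t ≤ n ↔ t < μ.real (Set.Iic n) :=
  ⟨fun h => lt_of_lt_of_le (Nat.sInf_mem (exists_lt_measureReal_Iic ht))
    (measureReal_mono (Set.Iic_subset_Iic.2 h)), fun h => Nat.sInf_le h⟩

lemma measurable_natQuantile : Measurable (natQuantile μ) := by
  refine measurable_of_Iic fun n => ?_
  have hset : natQuantile μ ⁻¹' Set.Iic n =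
      Set.Iio (μ.real (Set.Iic n)) ∪ Set.Ici (μ.real Set.univ) := by
    ext t
    obtain ht | ht := lt_or_ge t (μ.real Set.univ)
    · simp [natQuantile_le_iff ht, ht]
    · have hempty : {n | t < μ.real (Set.Iic n)} = ∅ := Set.eq_empty_of_forall_notMem fun n hn =>
        (hn.trans_le (measureReal_mono (Set.subset_univ _))).not_ge ht
      simp [natQuantile, hempty, ht]
  rw [hset]
  exact measurableSet_Iio.union measurableSet_Ici

lemma map_natQuantile :
    (volume.restrict (Set.Ico 0 (μ.real Set.univ))).map (natQuantile μ) = μ := by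
  refine Measure.ext_of_Iic _ _ fun n => ?_
  rw [Measure.map_apply measurable_natQuantile measurableSet_Iic,
    Measure.restrict_apply (measurable_natQuantile measurableSet_Iic)]
  have hset : natQuantile μ ⁻¹' Set.Iic n ∩ Set.Ico 0 (μ.real Set.univ) =
      Set.Ico 0 (μ.real (Set.Iic n)) := by
    ext t
    constructor
    · rintro ⟨hn, h0, ht⟩
      exact ⟨h0, (natQuantile_le_iff ht).1 hn⟩
    · rintro ⟨h0, hn⟩
      have ht := hn.trans_le (measureReal_mono (μ := μ) (Set.subset_univ (Set.Iic n)))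
      exact ⟨(natQuantile_le_iff ht).2 hn, h0, ht⟩
  rw [hset, Real.volume_Ico, sub_zero, ofReal_measureReal]

lemma restrict_Ici_Iic_le_sub_restrict_Iio_Iio {m : ℕ} (hle : μ.restrict (Set.Iio m) ≤ ν)
    (hdom : ∀ n, m ≤ n → μ (Set.Iic n) ≤ ν (Set.Iio n)) (n : ℕ) :
    μ.restrict (Set.Ici m) (Set.Iic n) ≤ (ν - μ.restrict (Set.Iio m)) (Set.Iio n) := by
  obtain hn | hn := lt_or_ge n m
  · rw [Measure.restrict_apply measurableSet_Iic, Set.inter_comm, Set.Ici_inter_Iic,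
      Set.Icc_eq_empty hn.not_ge, measure_empty]
    exact zero_le
  · refine (ENNReal.add_le_add_iff_left
      (measure_ne_top (μ.restrict (Set.Iio m)) (Set.Iio n))).1 ?_
    calc μ.restrict (Set.Iio m) (Set.Iio n) + μ.restrict (Set.Ici m) (Set.Iic n)
        ≤ μ.restrict (Set.Iio m) (Set.Iic n) + μ.restrict (Set.Ici m) (Set.Iic n) := by
          gcongr
          exact Set.Iio_subset_Iic_self
      _ = μ (Set.Iic n) := by rw [← Measure.add_apply, restrict_Iio_add_restrict_Ici]
      _ ≤ ν (Set.Iio n) := hdom n hn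
      _ = _ := by rw [← Measure.add_apply, add_comm, Measure.sub_add_cancel_of_le hle]

variable [IsFiniteMeasure ν]

lemma exists_coupling_snd_lt_fst (huniv : μ Set.univ = ν Set.univ)
    (hdom : ∀ n, μ (Set.Iic n) ≤ ν (Set.Iio n)) :
    ∃ q : Measure (ℕ × ℕ), q.fst = μ ∧ q.snd = ν ∧ ∀ᵐ x ∂q, x.2 < x.1 := by
  have hmass : μ.real Set.univ = ν.real Set.univ := by simp [measureReal_def, huniv]
  have hpair : Measurable fun t => (natQuantile μ t, natQuantile ν t) :=
    measurable_natQuantile.prodMk measurable_natQuantile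
  refine ⟨(volume.restrict (Set.Ico 0 (μ.real Set.univ))).map
    fun t => (natQuantile μ t, natQuantile ν t), ?_, ?_, ?_⟩
  · rw [Measure.fst_map_prodMk measurable_natQuantile, map_natQuantile]
  · rw [Measure.snd_map_prodMk measurable_natQuantile, hmass, map_natQuantile]
  · rw [ae_map_iff hpair.aemeasurable .of_discrete]
    refine (ae_restrict_iff' measurableSet_Ico).2 (.of_forall fun t ht => ?_)
    have hlt : t < ν.real (Set.Iio (natQuantile μ t)) :=
      ((natQuantile_le_iff ht.2).1 le_rfl).trans_le
        (ENNReal.toReal_mono (measure_ne_top _ _) (hdom _))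
    cases hn : natQuantile μ t with
    | zero => exact absurd hlt (by simpa [hn] using ht.1)
    | succ n =>
      rw [hn, show Set.Iio (n + 1) = Set.Iic n from Order.Iio_succ n] at hlt
      exact Nat.lt_succ_of_le ((natQuantile_le_iff (hmass ▸ ht.2)).2 hlt)

theorem exists_coupling_eq_or_snd_lt_fst (huniv : μ Set.univ = ν Set.univ) {m : ℕ}
    (hkeep : ∀ n < m, μ {n} ≤ ν {n})
    (hdom : ∀ n, m ≤ n → μ (Set.Iic n) ≤ ν (Set.Iio n)) :
    ∃ q : Measure (ℕ × ℕ), q.fst = μ ∧ q.snd = ν ∧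
      ∀ᵐ x ∂q, (x.1 < m → x.2 = x.1) ∧ (m ≤ x.1 → x.2 < x.1) := by
  have hle := restrict_Iio_le_of_singleton_le hkeep
  have hadd := restrict_Iio_add_restrict_Ici μ m
  have hsub : μ.restrict (Set.Iio m) + (ν - μ.restrict (Set.Iio m)) = ν := by
    rw [add_comm, Measure.sub_add_cancel_of_le hle]
  have huniv' : μ.restrict (Set.Ici m) Set.univ = (ν - μ.restrict (Set.Iio m)) Set.univ := by
    refine (ENNReal.add_right_inj (measure_ne_top (μ.restrict (Set.Iio m)) Set.univ)).1 ?_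
    rw [← Measure.add_apply, ← Measure.add_apply, hadd, hsub, huniv]
  obtain ⟨q, hfst, hsnd, hq⟩ := exists_coupling_snd_lt_fst huniv'
    (restrict_Ici_Iic_le_sub_restrict_Iio_Iio hle hdom)
  have hdiag : Measurable fun n : ℕ => (n, n) := measurable_id.prodMk measurable_id
  refine ⟨(μ.restrict (Set.Iio m)).map (fun n => (n, n)) + q, ?_, ?_, ?_⟩
  · rw [Measure.fst_add, Measure.fst_map_prodMk measurable_id', Measure.map_id', hfst, hadd]
  · rw [Measure.snd_add, Measure.snd_map_prodMk measurable_id', Measure.map_id', hsnd, hsub]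
  · have hfst_ge : ∀ᵐ x ∂q, m ≤ x.1 := by
      refine ae_of_ae_map measurable_fst.aemeasurable (p := fun n => m ≤ n) ?_
      rw [← Measure.fst, hfst]
      exact ae_restrict_mem measurableSet_Ici
    refine ae_add_measure_iff.2 ⟨?_, ?_⟩
    · rw [ae_map_iff hdiag.aemeasurable .of_discrete]
      filter_upwards [ae_restrict_mem measurableSet_Iio] with n hn
      exact ⟨fun _ => rfl, fun hmn => absurd hn hmn.not_gt⟩
    · filter_upwards [hq, hfst_ge] with x hx hmx
      exact ⟨fun hlt => absurd hmx hlt.not_ge, fun _ => hx⟩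

end NatCoupling

section PoissonWeights

lemma measure_Iic_le_measure_Iio_of_singleton_le {μ ν : Measure ℕ} [IsProbabilityMeasure μ]
    [IsProbabilityMeasure ν] {n : ℕ} (h : ∀ k, n ≤ k → ν {k} ≤ μ {k + 1}) :
    μ (Set.Iic n) ≤ ν (Set.Iio n) := by
  have hsucc : MeasurableEmbedding Nat.succ :=
    ⟨Nat.succ_injective, .of_discrete, fun _ _ => .of_discrete⟩
  have hle : ν.restrict (Set.Ici n) ≤ μ.comap Nat.succ := measure_le_of_singleton_le fun k => by
    rw [Measure.restrict_apply (measurableSet_singleton k), hsucc.comap_apply, Set.image_singleton]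
    obtain hk | hk := lt_or_ge k n
    · simp [hk]
    · exact (measure_mono Set.inter_subset_left).trans (h k hk)
  have htail : ν (Set.Ici n) ≤ μ (Set.Ioi n) := by
    have himage : Nat.succ '' Set.Ici n = Set.Ioi n :=
      (Set.image_add_const_Ici 1 n).trans (Order.Ici_succ n)
    have := hle (Set.Ici n)
    rwa [Measure.restrict_apply_self, hsucc.comap_apply, himage] at this
  rw [← Set.compl_Ioi, ← Set.compl_Ici, prob_compl_eq_one_sub measurableSet_Ioi,
    prob_compl_eq_one_sub measurableSet_Ici]
  exact tsub_le_tsub_left htail 1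

lemma poissonMeasure_singleton_le_singleton_succ {r s : ℝ≥0} (hsr : 2 * s ≤ r) {m : ℕ}
    (hm : poissonMeasure s {m} ≤ poissonMeasure r {m + 1}) {k : ℕ} (hk : m ≤ k) :
    poissonMeasure s {k} ≤ poissonMeasure r {k + 1} := by
  have hsucc (t : ℝ≥0) (n : ℕ) : poissonMeasure t {n + 1} =
      ENNReal.ofReal (t / (n + 1)) * poissonMeasure t {n} := by
    rw [poissonMeasure_singleton, poissonMeasure_singleton, ← ENNReal.ofReal_mul (by positivity),
      pow_succ, Nat.factorial_succ]
    push_cast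
    congr 1
    field_simp
  induction k, hk using Nat.le_induction with
  | base => exact hm
  | succ k _ ih =>
    have hsr' : (2 * s : ℝ) ≤ r := by exact_mod_cast hsr
    have hratio : (s / (k + 1) : ℝ) ≤ r / ((k + 1 : ℕ) + 1) := by
      rw [div_le_div_iff₀ (by positivity) (by positivity)]
      calc (s * ((k + 1 : ℕ) + 1) : ℝ) ≤ s * (2 * (k + 1)) := by
            gcongr
            push_cast
            linarith [Nat.cast_nonneg (α := ℝ) k]
        _ = 2 * s * (k + 1) := by ring
        _ ≤ r * (k + 1) := by gcongr
    rw [hsucc s, hsucc r (k + 1)]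
    exact mul_le_mul' (ENNReal.ofReal_le_ofReal hratio) ih

lemma poissonMeasure_Iio (r : ℝ≥0) (n : ℕ) : poissonMeasure r (Set.Iio n) =
    ENNReal.ofReal (∑ k ∈ Finset.range n, Real.exp (-r) * r ^ k / k.factorial) := by
  rw [ENNReal.ofReal_sum_of_nonneg fun k _ => by positivity]
  simp only [← poissonMeasure_singleton]
  rw [sum_measure_singleton, Finset.coe_range]

theorem poissonThinningExists_smul {α : Type*} [MeasurableSpace α] [StandardBorelSpace α]
    {ρ : Measure α} [IsProbabilityMeasure ρ] [NullSingletonClass ρ] {r s : ℝ≥0} (hr : 0 < r)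
    (hsr : 2 * s ≤ r) (hone : r * Real.exp (-r) ≤ s * Real.exp (-s))
    (htwo : (1 + r + r ^ 2 / 2) * Real.exp (-r) ≤ (1 + s) * Real.exp (-s))
    (hthree : s ^ 3 / 6 * Real.exp (-s) ≤ r ^ 4 / 24 * Real.exp (-r)) :
    PoissonThinningExists (r • ρ) (s • ρ) := by
  have hzero : Real.exp (-r) ≤ Real.exp (-s) := by
    have : (s : ℝ) ≤ r := by exact_mod_cast (le_mul_of_one_le_left' one_le_two).trans hsr
    gcongr
  have hkeep (n : ℕ) (hn : n < 2) : poissonMeasure r {n} ≤ poissonMeasure s {n} := by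
    rw [poissonMeasure_singleton, poissonMeasure_singleton]
    refine ENNReal.ofReal_le_ofReal ?_
    interval_cases n <;> norm_num <;> linarith [hzero, hone]
  have hdom (n : ℕ) (hn : 2 ≤ n) : poissonMeasure r (Set.Iic n) ≤ poissonMeasure s (Set.Iio n) := by
    obtain rfl | hn := hn.eq_or_lt
    · rw [← Order.Iio_succ, poissonMeasure_Iio, poissonMeasure_Iio]
      refine ENNReal.ofReal_le_ofReal ?_
      norm_num [Finset.sum_range_succ]
      linarith
    · refine measure_Iic_le_measure_Iio_of_singleton_le fun k hk =>
        poissonMeasure_singleton_le_singleton_succ hsr (m := 3) ?_ (Nat.le_trans hn hk)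
      rw [poissonMeasure_singleton, poissonMeasure_singleton]
      refine ENNReal.ofReal_le_ofReal ?_
      norm_num [Nat.factorial]
      linarith
  obtain ⟨q, hfst, hsnd, hq⟩ := exists_coupling_eq_or_snd_lt_fst (by simp) hkeep hdom
  refine poissonThinningExists_of_coupling hr hfst hsnd fun n => ?_
  obtain hn | hn := lt_or_ge n 2
  · exact .inl (hq.mono fun x hx hxn => (hx.1 (hxn ▸ hn)).trans hxn)
  · exact .inr (hq.mono fun x hx hxn => hxn ▸ hx.2 (hxn ▸ hn))

end PoissonWeights

section Intensities

lemma exp_three_quarters_gt : 2.1 < Real.exp 0.75 := by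
  refine lt_of_pow_lt_pow_left₀ 4 (Real.exp_pos _).le ?_
  rw [← Real.exp_nat_mul, show ((4 : ℕ) : ℝ) * 0.75 = (3 : ℕ) * 1 by norm_num, Real.exp_nat_mul]
  exact lt_trans (by norm_num) (pow_lt_pow_left₀ Real.exp_one_gt_d9 (by norm_num) (by norm_num))

lemma exp_three_quarters_lt : Real.exp 0.75 < 3 := by
  refine lt_of_pow_lt_pow_left₀ 4 (by norm_num) ?_
  rw [← Real.exp_nat_mul, show ((4 : ℕ) : ℝ) * 0.75 = (3 : ℕ) * 1 by norm_num, Real.exp_nat_mul]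
  exact (pow_lt_pow_left₀ Real.exp_one_lt_d9 (Real.exp_pos _).le (by norm_num)).trans (by norm_num)

lemma exp_eighty_five_hundredths_lt : Real.exp 0.85 < 2.41 := by
  refine lt_of_pow_lt_pow_left₀ 20 (by norm_num) ?_
  rw [← Real.exp_nat_mul, show ((20 : ℕ) : ℝ) * 0.85 = (17 : ℕ) * 1 by norm_num,
    Real.exp_nat_mul]
  exact (pow_lt_pow_left₀ Real.exp_one_lt_d9 (Real.exp_pos _).le (by norm_num)).trans (by norm_num)

variable {α : Type*} [MeasurableSpace α] (ρ : Measure α) [IsProbabilityMeasure ρ]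

lemma poissonThinningExists_seven_tenths [StandardBorelSpace α] [NullSingletonClass ρ] :
    PoissonThinningExists ((1.45 : ℝ≥0) • ρ) ((0.7 : ℝ≥0) • ρ) := by
  have hexp : Real.exp (-0.7) = Real.exp 0.75 * Real.exp (-1.45) := by
    rw [← Real.exp_add]
    norm_num
  have hpos := Real.exp_pos (-1.45)
  refine poissonThinningExists_smul (by norm_num) ?_ ?_ ?_ ?_
  · rw [← NNReal.coe_le_coe]
    norm_num
  all_goals push_cast; rw [hexp]; nlinarith [exp_three_quarters_gt, exp_three_quarters_lt]

lemma not_poissonThinningExists_six_tenths [MeasurableSingletonClass α] :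
    ¬ PoissonThinningExists ((1.45 : ℝ≥0) • ρ) ((0.6 : ℝ≥0) • ρ) := by
  have hexp : Real.exp (-0.6) = Real.exp 0.85 * Real.exp (-1.45) := by
    rw [← Real.exp_add]
    norm_num
  refine not_poissonThinningExists_smul ?_ ?_ <;> push_cast <;> rw [hexp] <;>
    nlinarith [exp_eighty_five_hundredths_lt, Real.exp_pos (-1.45)]

end Intensities

theorem thinningExists_and_not_thinningExists_div {E : Type*} [MeasureSpace E]
    [StandardBorelSpace E] [NullSingletonClass (volume : Measure E)] {S : Set E}
    (hS : MeasurableSet S) {v : ℝ≥0} (hv : volume S = v) (hv0 : v ≠ 0) :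
    ThinningExists S (1.45 / v) (0.7 / v) ∧ ¬ ThinningExists S (1.45 / v) (0.6 / v) := by
  have := hS.standardBorel
  let m : Measure S := volume.comap Subtype.val
  have hm (B : Set S) : m B = volume (Subtype.val '' B) :=
    (MeasurableEmbedding.subtype_coe hS).comap_apply _ _
  have hprob : IsProbabilityMeasure (v⁻¹ • m) := ⟨by
    rw [Measure.smul_apply, hm, Set.image_univ, Subtype.range_coe, hv, ENNReal.smul_def,
      smul_eq_mul, ← ENNReal.coe_mul, inv_mul_cancel₀ hv0, ENNReal.coe_one]⟩
  have hnull : NullSingletonClass (v⁻¹ • m) := ⟨fun x => by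
    rw [Measure.smul_apply, hm, Set.image_singleton, measure_singleton, smul_zero]⟩
  have hscale (r s : ℝ≥0) : ThinningExists S (r / v) (s / v) ↔
      PoissonThinningExists (r • v⁻¹ • m) (s • v⁻¹ • m) := by
    rw [smul_smul, smul_smul, ← div_eq_mul_inv, ← div_eq_mul_inv]
    rfl
  exact ⟨(hscale _ _).2 (poissonThinningExists_seven_tenths _),
    (hscale _ _).not.2 (not_poissonThinningExists_six_tenths _)⟩

theorem mainTheorem5_general {E : Type*} [MeasureSpace E] [StandardBorelSpace E]
    [NullSingletonClass (volume : Measure E)] {S : Set E} (hS : MeasurableSet S) :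
    (0 < volume S → volume S < ∞ → ∃ r s s' : ℝ≥0, 0 < s' ∧ s' < s ∧ s < r ∧
      ThinningExists S r s ∧ ¬ ThinningExists S r s') ∧
    (volume S = 1 → ThinningExists S 1.45 0.7 ∧ ¬ ThinningExists S 1.45 0.6) := by
  refine ⟨fun hpos hfin => ?_, fun hone => ?_⟩
  · lift volume S to ℝ≥0 using hfin.ne with v hv
    have hv0 : 0 < v := by exact_mod_cast hpos
    have h := thinningExists_and_not_thinningExists_div hS hv.symm hv0.ne'
    exact ⟨1.45 / v, 0.7 / v, 0.6 / v, div_pos (by norm_num) hv0,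
      div_lt_div_of_pos_right (by norm_num) hv0, div_lt_div_of_pos_right (by norm_num) hv0, h⟩
  · simpa using thinningExists_and_not_thinningExists_div hS (v := 1) (by simpa using hone)
      one_ne_zero

theorem mainTheorem5 :
    (∀ (d : ℕ) (S : Set (EuclideanSpace ℝ (Fin d))), 1 ≤ d → MeasurableSet S →
      0 < volume S → volume S < ∞ →
      ∃ r s s' : ℝ≥0, 0 < s' ∧ s' < s ∧ s < r ∧
        ThinningExists S r s ∧ ¬ ThinningExists S r s') ∧
    (∀ (d : ℕ) (S : Set (EuclideanSpace ℝ (Fin d))), 1 ≤ d → MeasurableSet S →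
      volume S = 1 →
      ThinningExists S 1.45 0.7 ∧ ¬ ThinningExists S 1.45 0.6) ∧
    (ThinningExists (Set.Icc (0 : ℝ) 1) 1.45 0.7 ∧
      ¬ ThinningExists (Set.Icc (0 : ℝ) 1) 1.45 0.6) := by
  have hnull (d : ℕ) (hd : 1 ≤ d) :
      NullSingletonClass (volume : Measure (EuclideanSpace ℝ (Fin d))) := by
    have : Nonempty (Fin d) := ⟨⟨0, hd⟩⟩
    infer_instance
  refine ⟨fun d S hd hS => ?_, fun d S hd hS => ?_, ?_⟩
  · have := hnull d hd
    exact (mainTheorem5_general hS).1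
  · have := hnull d hd
    exact (mainTheorem5_general hS).2
  · exact (mainTheorem5_general measurableSet_Icc).2 (by simp)
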